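/- Let $M$ be a smooth $2$-dimensional manifold, let $\Omega$ be the canonical symplectic form of $T^*M$, and let $\omega$ be a smooth $2$-form on $T^*M$ with $\omega\wedge\Omega=0$ (a Monge–Ampère structure $(\Omega,\omega)$ on $M$). Let the function $\mathrm{Pf}(\omega)$ be defined by $\mathrm{Pf}(\omega)\,\Omega\wedge\Omega=\omega\wedge\omega$. Assume that $\mathrm{Pf}(\omega)$ vanishes nowhere and that the normalized form $\widetilde\omega=\omega/\sqrt{|\mathrm{Pf}(\omega)|}$ satisfies $d\widetilde\omega=0$. For a non-degenerate $2$-form $\tau$ put $\tau^\flat X=-i_X\tau$, and let $\pi_\tau^\sharp=(\tau^\flat)^{-1}$. Let $J_\omega=\pi_\Omega^\sharp\circ\widetilde\omega^\flat$, i.e. $\Omega(J_\omega X,Y)=\widetilde\omega(X,Y)$. Then $J_\omega$ is a smooth $(1,1)$-tensor on $T^*M$ with vanishing Nijenhuis torsion and with $\mathrm{Tr}\,J_\omega=0$. The vector bundle $T(T^*M)$ with anchor $J_\omega$ and bracket $$[X,Y]_{J_\omega}=[J_\omega X,Y]+[X,J_\omega Y]-J_\omega[X,Y]$$ is a Lie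 algebroid. The $1$-form $d(\mathrm{Tr}\,J_\omega)$ is closed for the differential of this Lie algebroid, and its class in the first Lie algebroid cohomology is the modular class. This class is zero, i.e. the deformed Lie algebroid is unimodular. Here the modular class of a Lie algebroid $A\to N$ with anchor $\rho$, $A$ and $N$ orientable, is the class of the $1$-form $\xi$ on $A$ determined by $D_Xs=\xi(X)s$, where $s$ is a nowhere-vanishing section of $\wedge^{\rm top}A\otimes\wedge^{\rm top}T^*N$ and $D_X(P\otimes\nu)=[X,P]\otimes\nu+P\otimes\mathcal L_{\rho(X)}\nu$; it does not depend on $s$. -/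

import Mathlib

open Set Bundle VectorField
open scoped Manifold ContDiff Topology

noncomputable section

section Algebroid

variable {E : Type*} [NormedAddCommGroup E] [NormedSpace ℝ E]
  {H : Type*} [TopologicalSpace H] (I : ModelWithCorners ℝ E H)
  {N : Type*} [TopologicalSpace N] [ChartedSpace H N] [IsManifold I ∞ N]
  (F : Type*) [NormedAddCommGroup F] [NormedSpace ℝ F]
  (A : N → Type*) [TopologicalSpace (TotalSpace F A)]
  [∀ x, AddCommGroup (A x)] [∀ x, Module ℝ (A x)] [∀ x, TopologicalSpace (A x)]
  [FiberBundle F A] [VectorBundle ℝ F A]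

/-- The product `f X` of a smooth function and a smooth section. -/
def ContMDiffSection.funSMul {I : ModelWithCorners ℝ E H} {N : Type*} [TopologicalSpace N]
    [ChartedSpace H N] {F : Type*} [NormedAddCommGroup F]
    [NormedSpace ℝ F] {A : N → Type*} [TopologicalSpace (TotalSpace F A)]
    [∀ x, AddCommGroup (A x)] [∀ x, Module ℝ (A x)] [∀ x, TopologicalSpace (A x)]
    [FiberBundle F A] [VectorBundle ℝ F A]
    (f : C^∞⟮I, N; 𝓘(ℝ, ℝ), ℝ⟯) (X : Cₛ^∞⟮I; F, A⟯) : Cₛ^∞⟮I; F, A⟯ :=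
  ⟨fun x => f x • X x, f.contMDiff.smul_section X.contMDiff⟩

/-- A Lie algebroid structure on the vector bundle `A → N`: a smooth bundle map
`ρ : A → TN` (the anchor) and a Lie bracket on the space of smooth sections of `A` such that
`[X, f Y] = f [X, Y] + (ρ(X) f) Y`. (Homogeneity of the bracket over `ℝ` is the case of a
constant `f` of the last law.) -/
structure LieAlgebroid where
  /-- the anchor -/
  anchor : ∀ x : N, A x →ₗ[ℝ] TangentSpace I x
  contMDiff_anchor : ∀ X : Cₛ^∞⟮I; F, A⟯,
    ContMDiff I I.tangent ∞ (fun x => (⟨x, anchor x (X x)⟩ : TangentBundle I N))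
  /-- the bracket of sections -/
  bracket : Cₛ^∞⟮I; F, A⟯ → Cₛ^∞⟮I; F, A⟯ → Cₛ^∞⟮I; F, A⟯
  bracket_add : ∀ X Y Z, bracket X (Y + Z) = bracket X Y + bracket X Z
  bracket_skew : ∀ X Y, bracket X Y = - bracket Y X
  jacobi : ∀ X Y Z,
    bracket X (bracket Y Z) = bracket (bracket X Y) Z + bracket Y (bracket X Z)
  leibniz : ∀ (X Y : Cₛ^∞⟮I; F, A⟯) (f : C^∞⟮I, N; 𝓘(ℝ, ℝ), ℝ⟯) (x : N),
    bracket X (Y.funSMul f) x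
      = f x • bracket X Y x + mvfderiv I f x (anchor x (X x)) • Y x

/-- A smooth field of endomorphisms (a `(1,1)`-tensor) on the vector bundle `A`. -/
structure EndField where
  /-- the endomorphism of each fibre -/
  toFun : ∀ x : N, A x →ₗ[ℝ] A x
  smooth : ∀ X : Cₛ^∞⟮I; F, A⟯,
    ContMDiff I (I.prod 𝓘(ℝ, F)) ∞ (fun x => TotalSpace.mk' F x (toFun x (X x)))

/-- Smooth `k`-forms on `A`, i.e. smooth sections of `⋀ᵏ A*`: fields of alternating `k`-linear
forms on the fibres that give smooth functions when evaluated on smooth sections. -/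
def smoothForms (k : ℕ) : Submodule ℝ (∀ x : N, A x [⋀^Fin k]→L[ℝ] ℝ) where
  carrier := {α | ∀ X : Fin k → Cₛ^∞⟮I; F, A⟯,
    ContMDiff I 𝓘(ℝ, ℝ) ∞ (fun x => α x (fun i => X i x))}
  add_mem' := fun ha hb X => (ha X).add (hb X)
  zero_mem' := fun _ => contMDiff_const
  smul_mem' := fun c _ ha X => by
    have h : ContMDiff I 𝓘(ℝ, ℝ) ∞ (fun _ : N => c) := contMDiff_const
    exact h.smul (ha X)

/-- A volume form on `A`: a smooth nowhere-vanishing form of top degree. -/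
def IsVolumeForm (l : ∀ x : N, A x [⋀^Fin (Module.finrank ℝ F)]→L[ℝ] ℝ) : Prop :=
  l ∈ smoothForms I F A (Module.finrank ℝ F) ∧ ∀ x, l x ≠ 0

variable {I F A}

/-- The section `x ↦ P_x (X x)`. -/
def EndField.app (P : EndField I F A) (X : Cₛ^∞⟮I; F, A⟯) : Cₛ^∞⟮I; F, A⟯ :=
  ⟨fun x => P.toFun x (X x), P.smooth X⟩

namespace LieAlgebroid

variable (L : LieAlgebroid I F A)

/-- The derivative `ρ(X) f` of a function along a section of `A`. -/
def der (X : Cₛ^∞⟮I; F, A⟯) (f : N → ℝ) (x : N) : ℝ := mvfderiv I f x (L.anchor x (X x))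

/-- The vector field `ρ(X)`. -/
def anchorSection (X : Cₛ^∞⟮I; F, A⟯) :
    Cₛ^∞⟮I; E, (fun x : N => TangentSpace I x)⟯ :=
  ⟨fun x => L.anchor x (X x), L.contMDiff_anchor X⟩

/-- The deformed bracket `[X, Y]_P = [P X, Y] + [X, P Y] - P [X, Y]`. -/
def deformedBracket (P : EndField I F A) (X Y : Cₛ^∞⟮I; F, A⟯) : Cₛ^∞⟮I; F, A⟯ :=
  L.bracket (P.app X) Y + L.bracket X (P.app Y) - P.app (L.bracket X Y)

/-- The Nijenhuis torsion of `P` vanishes: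
`[P X, P Y] - P ([P X, Y] + [X, P Y]) + P² [X, Y] = 0`. -/
def IsNijenhuis (P : EndField I F A) : Prop :=
  ∀ X Y : Cₛ^∞⟮I; F, A⟯,
    L.bracket (P.app X) (P.app Y) - P.app (L.bracket (P.app X) Y + L.bracket X (P.app Y))
      + P.app (P.app (L.bracket X Y)) = 0

/-- `L'` is the Lie algebroid structure on `A` obtained by deforming `L` by `P`: its anchor is
`ρ ∘ P` and its bracket is the deformed bracket. -/
structure IsDeformation (L' : LieAlgebroid I F A) (P : EndField I F A) : Prop where
  anchor_eq : ∀ x, L'.anchor x = L.anchor x ∘ₗ P.toFun x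
  bracket_eq : ∀ X Y, L'.bracket X Y = L.deformedBracket P X Y

/-- The Lie derivative of a `k`-form on `A` along a section `X`:
`(𝓛_X α)(Y₁, …, Y_k) = ρ(X)(α(Y₁, …, Y_k)) - ∑ᵢ α(Y₁, …, [X, Yᵢ], …, Y_k)`. -/
def lieDer {k : ℕ} (X : Cₛ^∞⟮I; F, A⟯) (α : ∀ x : N, A x [⋀^Fin k]→L[ℝ] ℝ)
    (Y : Fin k → Cₛ^∞⟮I; F, A⟯) (x : N) : ℝ :=
  L.der X (fun y => α y (fun i => Y i y)) x
    - ∑ i, α x (fun j => Function.update Y i (L.bracket X (Y i)) j x)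

/-- The smooth `1`-forms `ξ` on `A` that are closed for the Lie algebroid differential:
`ρ(X)(ξ(Y)) - ρ(Y)(ξ(X)) - ξ([X, Y]) = 0`. -/
def cocycles : Submodule ℝ (∀ x : N, A x →ₗ[ℝ] ℝ) where
  carrier := {ξ | (∀ X : Cₛ^∞⟮I; F, A⟯, ContMDiff I 𝓘(ℝ, ℝ) ∞ (fun x => ξ x (X x))) ∧
    ∀ (X Y : Cₛ^∞⟮I; F, A⟯) (x : N),
      L.der X (fun y => ξ y (Y y)) x - L.der Y (fun y => ξ y (X y)) x
        - ξ x (L.bracket X Y x) = 0}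
  add_mem' := by
    rintro a b ⟨ha, ha'⟩ ⟨hb, hb'⟩
    refine ⟨fun X => (ha X).add (hb X), fun X Y x => ?_⟩
    have h1 := ha' X Y x
    have h2 := hb' X Y x
    have e1 : ∀ X Y : Cₛ^∞⟮I; F, A⟯, L.der X (fun y => (a + b) y (Y y)) x
        = L.der X (fun y => a y (Y y)) x + L.der X (fun y => b y (Y y)) x := fun X Y => by
      have := mvfderiv_add ((ha Y x).mdifferentiableAt (by simp))
        ((hb Y x).mdifferentiableAt (by simp))
      exact congrArg (fun T => T (L.anchor x (X x))) this
    rw [e1, e1]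
    simp only [Pi.add_apply, LinearMap.add_apply]
    linarith
  zero_mem' := by
    refine ⟨fun X => contMDiff_const, fun X Y x => ?_⟩
    simp [der, mvfderiv_const]
  smul_mem' := by
    rintro c a ⟨ha, ha'⟩
    have hc : ContMDiff I 𝓘(ℝ, ℝ) ∞ (fun _ : N => c) := contMDiff_const
    refine ⟨fun X => hc.smul (ha X), fun X Y x => ?_⟩
    have h1 := ha' X Y x
    have e1 : ∀ X Y : Cₛ^∞⟮I; F, A⟯, L.der X (fun y => (c • a) y (Y y)) x
        = c * L.der X (fun y => a y (Y y)) x := fun X Y => by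
      have := mvfderiv_mul ((hc x).mdifferentiableAt (by simp))
        ((ha Y x).mdifferentiableAt (by simp))
      rw [mvfderiv_const, smul_zero, add_zero] at this
      exact congrArg (fun T => T (L.anchor x (X x))) this
    rw [e1, e1]
    simp only [Pi.smul_apply, LinearMap.smul_apply, smul_eq_mul]
    linear_combination c * h1

/-- The exact `1`-forms `d_A f = df ∘ ρ`, for smooth functions `f`. -/
def coboundaries : Submodule ℝ (∀ x : N, A x →ₗ[ℝ] ℝ) where
  carrier := {ξ | ∃ f : C^∞⟮I, N; 𝓘(ℝ, ℝ), ℝ⟯,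
    ∀ (x : N) (v : A x), ξ x v = mvfderiv I f x (L.anchor x v)}
  add_mem' := by
    rintro a b ⟨f, hf⟩ ⟨g, hg⟩
    refine ⟨f + g, fun x v => ?_⟩
    have := mvfderiv_add ((f.contMDiff x).mdifferentiableAt (by simp))
      ((g.contMDiff x).mdifferentiableAt (by simp))
    rw [Pi.add_apply, LinearMap.add_apply, hf, hg]
    exact (congrArg (fun T => T (L.anchor x v)) this).symm
  zero_mem' := by
    refine ⟨0, fun x v => ?_⟩
    have : mvfderiv I (fun _ : N => (0 : ℝ)) x = 0 := mvfderiv_const 0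
    exact (congrArg (fun T => T (L.anchor x v)) this).symm
  smul_mem' := by
    rintro c a ⟨f, hf⟩
    refine ⟨c • f, fun x v => ?_⟩
    have hc : ContMDiff I 𝓘(ℝ, ℝ) ∞ (fun _ : N => c) := contMDiff_const
    have := mvfderiv_mul ((hc x).mdifferentiableAt (by simp))
      ((f.contMDiff x).mdifferentiableAt (by simp))
    rw [mvfderiv_const, smul_zero, add_zero] at this
    rw [Pi.smul_apply, LinearMap.smul_apply, hf]
    exact (congrArg (fun T => T (L.anchor x v)) this).symm

/-- The first Lie algebroid cohomology space, closed `1`-forms modulo exact ones: the image of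
the closed forms in the quotient of all `1`-forms by the exact ones. -/
abbrev H1 : Type _ := L.cocycles.map L.coboundaries.mkQ

/-- The class of a closed `1`-form. -/
def classOf (ξ : ∀ x : N, A x →ₗ[ℝ] ℝ) (h : ξ ∈ L.cocycles) : L.H1 :=
  ⟨L.coboundaries.mkQ ξ, Submodule.mem_map_of_mem h⟩

end LieAlgebroid

end Algebroid

section Tangent

variable {E : Type*} [NormedAddCommGroup E] [NormedSpace ℝ E] [CompleteSpace E]
  {H : Type*} [TopologicalSpace H] (I : ModelWithCorners ℝ E H)
  (N : Type*) [TopologicalSpace N] [ChartedSpace H N] [IsManifold I ∞ N]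

/-- The standard Lie algebroid structure of the tangent bundle. -/
def tangentLieAlgebroid : LieAlgebroid I E (fun x : N => TangentSpace I x) where
  anchor x := LinearMap.id
  contMDiff_anchor X := X.contMDiff
  bracket X Y := ⟨mlieBracket I X Y, by
    have : IsManifold I (((⊤ : ℕ∞) : WithTop ℕ∞) + 1) N := by simpa using ‹IsManifold I ∞ N›
    have : IsManifold I (minSmoothness ℝ 2) N := by
      rw [minSmoothness_of_isRCLikeNormedField]; infer_instance
    exact ContDiff.mlieBracket_vectorField (n := ⊤) (m := ⊤) X.contMDiff Y.contMDiff (by simp)⟩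
  bracket_add X Y Z := by
    have : IsManifold I 2 N := inferInstance
    ext x
    exact mlieBracket_add_right ((Y.contMDiff x).mdifferentiableAt (by simp))
      ((Z.contMDiff x).mdifferentiableAt (by simp))
  bracket_skew X Y := by
    ext x
    exact mlieBracket_swap_apply
  jacobi X Y Z := by
    have h2 : minSmoothness ℝ 2 ≤ ∞ := by
      simpa using ENat.LEInfty.out (m := 2)
    have : IsManifold I (minSmoothness ℝ 3) N := by
      rw [minSmoothness_of_isRCLikeNormedField]; infer_instance
    ext x
    exact leibniz_identity_mlieBracket_apply ((X.contMDiff x).of_le h2)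
      ((Y.contMDiff x).of_le h2) ((Z.contMDiff x).of_le h2)
  leibniz X Y f x := by
    have : IsManifold I 2 N := inferInstance
    refine (mlieBracket_smul_right (V := X) (W := Y)
      ((f.contMDiff x).mdifferentiableAt (by simp))
      ((Y.contMDiff x).mdifferentiableAt (by simp))).trans ?_
    exact add_comm _ _

variable {N} in
/-- The exterior derivative of a `k`-form on a manifold: at `x`, the exterior derivative of the
expression of the form in the preferred chart at `x`. -/
def mextDeriv {k : ℕ} (α : ∀ x : N, TangentSpace I x [⋀^Fin k]→L[ℝ] ℝ) (x : N) :
    TangentSpace I x [⋀^Fin (k + 1)]→L[ℝ] ℝ :=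
  (extDerivWithin (𝕜 := ℝ) (E := E) (F := ℝ)
    (fun y : E => (α ((extChartAt I x).symm y)).compContinuousLinearMap
      (mfderivWithin 𝓘(ℝ, E) I (extChartAt I x).symm (range I) y))
    (range I) (extChartAt I x x)).compContinuousLinearMap
      (mfderiv I 𝓘(ℝ, E) (extChartAt I x) x)

namespace LieAlgebroid

variable {I N}
variable {F : Type*} [NormedAddCommGroup F] [NormedSpace ℝ F]
  {A : N → Type*} [TopologicalSpace (TotalSpace F A)]
  [∀ x, AddCommGroup (A x)] [∀ x, Module ℝ (A x)] [∀ x, TopologicalSpace (A x)]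
  [FiberBundle F A] [VectorBundle ℝ F A] (L : LieAlgebroid I F A)

/-- The `1`-form `ξ` on `A` is the modular form of `L` with respect to the volume forms `l` of
`A` and `v` of `N`: with `s = l⁻¹ ⊗ v`, a nowhere-vanishing section of
`⋀ᵗᵒᵖ A ⊗ ⋀ᵗᵒᵖ T*N`, and `D_X (P ⊗ v) = [X, P] ⊗ v + P ⊗ 𝓛_{ρ(X)} v`, one has
`D_X s = ξ(X) s`. Explicitly, `𝓛_{ρ(X)} v = b v` and `𝓛_X l = a l` with `ξ(X) = b - a`. -/
def IsModularForm (l : ∀ x : N, A x [⋀^Fin (Module.finrank ℝ F)]→L[ℝ] ℝ)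
    (v : ∀ x : N, TangentSpace I x [⋀^Fin (Module.finrank ℝ E)]→L[ℝ] ℝ)
    (ξ : ∀ x : N, A x →ₗ[ℝ] ℝ) : Prop :=
  ∀ (X : Cₛ^∞⟮I; F, A⟯) (Y : Fin (Module.finrank ℝ F) → Cₛ^∞⟮I; F, A⟯)
    (Z : Fin (Module.finrank ℝ E) → Cₛ^∞⟮I; E, (fun x : N => TangentSpace I x)⟯) (x : N),
    ξ x (X x) * (l x (fun i => Y i x) * v x (fun j => Z j x))
      = l x (fun i => Y i x) * (tangentLieAlgebroid I N).lieDer (L.anchorSection X) v Z x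
        - L.lieDer X l Y x * v x (fun j => Z j x)

/-- `c` is the modular class of the Lie algebroid `L` (with `A` and `N` orientable): the class of
a modular form of `L`. It does not depend on the chosen volume forms. -/
def IsModularClass (c : L.H1) : Prop :=
  ∃ (l : ∀ x : N, A x [⋀^Fin (Module.finrank ℝ F)]→L[ℝ] ℝ)
    (v : ∀ x : N, TangentSpace I x [⋀^Fin (Module.finrank ℝ E)]→L[ℝ] ℝ)
    (ξ : ∀ x : N, A x →ₗ[ℝ] ℝ) (h : ξ ∈ L.cocycles),
    IsVolumeForm I F A l ∧ IsVolumeForm I E (fun x : N => TangentSpace I x) v ∧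
      L.IsModularForm l v ξ ∧ c = L.classOf ξ h

/-- A Lie algebroid is unimodular if its modular class vanishes. -/
def IsUnimodular : Prop := L.IsModularClass 0

end LieAlgebroid

end Tangent

section LinearAlgebra

variable {V : Type*} [AddCommGroup V] [Module ℝ V] [TopologicalSpace V]

/-- The exterior product `α ∧ β` of two `2`-forms, as a function of four vectors. -/
def wedge (α β : V [⋀^Fin 2]→L[ℝ] ℝ) (v : Fin 4 → V) : ℝ :=
  α ![v 0, v 1] * β ![v 2, v 3] - α ![v 0, v 2] * β ![v 1, v 3]
    + α ![v 0, v 3] * β ![v 1, v 2] + α ![v 1, v 2] * β ![v 0, v 3]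
    - α ![v 1, v 3] * β ![v 0, v 2] + α ![v 2, v 3] * β ![v 0, v 1]

open Classical in
/-- The Pfaffian of `α` relative to `τ`: the number `c` such that `c τ ∧ τ = α ∧ α`. It exists
and is unique when `V` has dimension `4` and `τ` is non-degenerate. -/
def pfaffian (τ α : V [⋀^Fin 2]→L[ℝ] ℝ) : ℝ :=
  if h : ∃ c : ℝ, c • wedge τ τ = wedge α α then h.choose else 0

/-- The map `α♭ : X ↦ - i_X α` from vectors to covectors. -/
def flat (α : V [⋀^Fin 2]→L[ℝ] ℝ) : V →ₗ[ℝ] Module.Dual ℝ V :=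
  have u0 : ∀ X Y Z : V, Function.update ![X, Y] 0 Z = ![Z, Y] := fun X Y Z => by
    ext i; fin_cases i <;> simp
  have u1 : ∀ X Y Z : V, Function.update ![X, Y] 1 Z = ![X, Z] := fun X Y Z => by
    ext i; fin_cases i <;> simp
  LinearMap.mk₂ ℝ (fun X Y => - α ![X, Y])
    (fun X X' Y => by
      have h := α.map_update_add ![X, Y] 0 X X'
      rw [u0, u0, u0] at h
      linarith)
    (fun c X Y => by
      have h := α.map_update_smul ![X, Y] 0 c X
      rw [u0, u0] at h
      simp [h])
    (fun X Y Y' => by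
      have h := α.map_update_add ![X, Y] 1 Y Y'
      rw [u1, u1, u1] at h
      linarith)
    (fun c X Y => by
      have h := α.map_update_smul ![X, Y] 1 c Y
      rw [u1, u1] at h
      simp [h])

open Classical in
/-- The map `π_τ♯` of the bivector inverse to a non-degenerate `2`-form `τ`: the inverse
of `τ♭`. -/
def inverseSharp (τ : V [⋀^Fin 2]→L[ℝ] ℝ) : Module.Dual ℝ V →ₗ[ℝ] V :=
  if h : Function.Bijective (flat τ) then ((LinearEquiv.ofBijective (flat τ) h).symm : _ →ₗ[ℝ] _)
  else 0

end LinearAlgebra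

section Cotangent

variable {E : Type*} [NormedAddCommGroup E] [NormedSpace ℝ E]
  {H : Type*} [TopologicalSpace H] (I : ModelWithCorners ℝ E H)
  (M : Type*) [TopologicalSpace M] [ChartedSpace H M] [IsManifold I ∞ M]

/-- The cotangent bundle `T*M`. -/
abbrev CotangentBundle : Type _ :=
  TotalSpace (E →L[ℝ] ℝ) (fun x : M => TangentSpace I x →L[ℝ] Bundle.Trivial M ℝ x)

/-- The model of the manifold `T*M`. -/
abbrev cotangentModel : ModelWithCorners ℝ (E × (E →L[ℝ] ℝ)) (ModelProd H (E →L[ℝ] ℝ)) :=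
  I.prod 𝓘(ℝ, E →L[ℝ] ℝ)

/-- The tangent spaces of `T*M`. -/
abbrev TCotangent (z : CotangentBundle I M) : Type _ := TangentSpace (cotangentModel I) z

/-- The canonical (Liouville) `1`-form of `T*M`: `θ_(x, p)(w) = p (dπ w)`. -/
def canonicalOneForm (z : CotangentBundle I M) : TCotangent I M z →L[ℝ] ℝ :=
  (show TangentSpace I z.proj →L[ℝ] ℝ from z.2).comp
    (mfderiv (cotangentModel I) I (TotalSpace.proj : CotangentBundle I M → M) z)

/-- The canonical symplectic form `Ω = - dθ` of `T*M`. -/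
def canonicalTwoForm (z : CotangentBundle I M) : TCotangent I M z [⋀^Fin 2]→L[ℝ] ℝ :=
  - mextDeriv (cotangentModel I)
    (fun z => ContinuousAlternatingMap.ofSubsingleton ℝ _ _ (0 : Fin 1) (canonicalOneForm I M z)) z

variable {M}

/-- The Pfaffian of a `2`-form `w` on `T*M`: `Pf(w) Ω ∧ Ω = w ∧ w`. -/
def Pf (w : ∀ z : CotangentBundle I M, TCotangent I M z [⋀^Fin 2]→L[ℝ] ℝ)
    (z : CotangentBundle I M) : ℝ :=
  pfaffian (canonicalTwoForm I M z) (w z)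

/-- The normalized `2`-form `w / √|Pf(w)|`. -/
def normalizedForm (w : ∀ z : CotangentBundle I M, TCotangent I M z [⋀^Fin 2]→L[ℝ] ℝ)
    (z : CotangentBundle I M) : TCotangent I M z [⋀^Fin 2]→L[ℝ] ℝ :=
  (Real.sqrt |Pf I w z|)⁻¹ • w z

/-- The endomorphism `J_w = π_Ω♯ ∘ (w / √|Pf(w)|)♭` of the tangent spaces of `T*M`. -/
def normalizedTensor (w : ∀ z : CotangentBundle I M, TCotangent I M z [⋀^Fin 2]→L[ℝ] ℝ)
    (z : CotangentBundle I M) : TCotangent I M z →ₗ[ℝ] TCotangent I M z :=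
  inverseSharp (canonicalTwoForm I M z) ∘ₗ flat (normalizedForm I w z)

/-- `(Ω, w)` is a Monge-Ampère structure on the `2`-dimensional manifold `M`: `w` is a smooth
`2`-form on `T*M` with `w ∧ Ω = 0`. -/
def IsMongeAmpere (w : ∀ z : CotangentBundle I M, TCotangent I M z [⋀^Fin 2]→L[ℝ] ℝ) : Prop :=
  w ∈ smoothForms (cotangentModel I) (E × (E →L[ℝ] ℝ)) (TCotangent I M) 2 ∧
    ∀ z, wedge (w z) (canonicalTwoForm I M z) = 0

/-- The `1`-form `d (Tr P)` of a field of endomorphisms of the tangent spaces of `T*M`. -/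
def dTrace (P : ∀ z : CotangentBundle I M, TCotangent I M z →ₗ[ℝ] TCotangent I M z)
    (z : CotangentBundle I M) : TCotangent I M z →ₗ[ℝ] ℝ :=
  (mvfderiv (cotangentModel I) (fun z => LinearMap.trace ℝ (TCotangent I M z) (P z)) z).toLinearMap

end Cotangent

end

noncomputable section

set_option linter.unusedSectionVars false

section DeformationAlgebroid

variable {E : Type*} [NormedAddCommGroup E] [NormedSpace ℝ E]
  {H : Type*} [TopologicalSpace H] {I : ModelWithCorners ℝ E H}
  {N : Type*} [TopologicalSpace N] [ChartedSpace H N] [IsManifold I ∞ N]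
  {F : Type*} [NormedAddCommGroup F] [NormedSpace ℝ F]
  {A : N → Type*} [TopologicalSpace (TotalSpace F A)]
  [∀ x, AddCommGroup (A x)] [∀ x, Module ℝ (A x)] [∀ x, TopologicalSpace (A x)]
  [FiberBundle F A] [VectorBundle ℝ F A]

theorem ContMDiffSection.funSMul_apply (f : C^∞⟮I, N; 𝓘(ℝ, ℝ), ℝ⟯) (X : Cₛ^∞⟮I; F, A⟯) (x : N) :
    X.funSMul f x = f x • X x := rfl

namespace EndField

theorem app_apply (P : EndField I F A) (X : Cₛ^∞⟮I; F, A⟯) (x : N) :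
    P.app X x = P.toFun x (X x) := rfl

theorem app_add (P : EndField I F A) (X Y : Cₛ^∞⟮I; F, A⟯) :
    P.app (X + Y) = P.app X + P.app Y := by
  ext x; exact map_add (P.toFun x) (X x) (Y x)

theorem app_sub (P : EndField I F A) (X Y : Cₛ^∞⟮I; F, A⟯) :
    P.app (X - Y) = P.app X - P.app Y := by
  ext x; exact map_sub (P.toFun x) (X x) (Y x)

theorem app_neg (P : EndField I F A) (X : Cₛ^∞⟮I; F, A⟯) : P.app (-X) = -P.app X := by
  ext x; exact map_neg (P.toFun x) (X x)

theorem app_funSMul (P : EndField I F A) (f : C^∞⟮I, N; 𝓘(ℝ, ℝ), ℝ⟯) (X : Cₛ^∞⟮I; F, A⟯) :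
    P.app (X.funSMul f) = (P.app X).funSMul f := by
  ext x; exact map_smul (P.toFun x) (f x) (X x)

end EndField

namespace LieAlgebroid

variable (L : LieAlgebroid I F A)

theorem bracket_zero (X : Cₛ^∞⟮I; F, A⟯) : L.bracket X 0 = 0 := by
  simpa using L.bracket_add X 0 0

theorem bracket_neg (X Y : Cₛ^∞⟮I; F, A⟯) : L.bracket X (-Y) = -L.bracket X Y := by
  have h := L.bracket_add X Y (-Y)
  rw [add_neg_cancel, bracket_zero] at h
  exact (neg_eq_of_add_eq_zero_right h.symm).symm

theorem bracket_sub (X Y Z : Cₛ^∞⟮I; F, A⟯) :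
    L.bracket X (Y - Z) = L.bracket X Y - L.bracket X Z := by
  rw [sub_eq_add_neg, L.bracket_add, bracket_neg, sub_eq_add_neg]

theorem deformedBracket_skew (P : EndField I F A) (X Y : Cₛ^∞⟮I; F, A⟯) :
    L.deformedBracket P X Y = -L.deformedBracket P Y X := by
  rw [deformedBracket, deformedBracket, L.bracket_skew (P.app X), L.bracket_skew X,
    L.bracket_skew X, P.app_neg]
  abel

/-- The iterated deformed bracket of a Nijenhuis tensor, in a form symmetric in `X`, `Y`, `Z`
up to the position of the brackets. -/
theorem IsNijenhuis.deformedBracket_deformedBracket {P : EndField I F A} (hP : L.IsNijenhuis P)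
    (X Y Z : Cₛ^∞⟮I; F, A⟯) :
    L.deformedBracket P X (L.deformedBracket P Y Z)
      = L.bracket (P.app X) (L.bracket (P.app Y) Z) + L.bracket (P.app X) (L.bracket Y (P.app Z))
        + L.bracket X (L.bracket (P.app Y) (P.app Z))
        - P.app (L.bracket (P.app X) (L.bracket Y Z) + L.bracket X (L.bracket (P.app Y) Z)
            + L.bracket X (L.bracket Y (P.app Z)))
        + P.app (P.app (L.bracket X (L.bracket Y Z))) := by
  have h1 := hP Y Z
  have h2 := hP X (L.bracket Y Z)
  have h3 : P.app (L.deformedBracket P Y Z) = L.bracket (P.app Y) (P.app Z) := by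
    rw [deformedBracket, P.app_sub, ← sub_eq_zero, ← neg_eq_zero, ← h1]; abel
  have h4 : L.bracket (P.app X) (P.app (L.bracket Y Z))
      = P.app (L.bracket (P.app X) (L.bracket Y Z)) + P.app (L.bracket X (P.app (L.bracket Y Z)))
        - P.app (P.app (L.bracket X (L.bracket Y Z))) := by
    rw [← sub_eq_zero, ← h2, P.app_add]; abel
  rw [deformedBracket, h3]
  simp only [deformedBracket, bracket_add, bracket_sub, P.app_add, P.app_sub, h4]
  abel

/-- The deformation of a Lie algebroid by a Nijenhuis tensor. -/
def deform (P : EndField I F A) (hP : L.IsNijenhuis P) : LieAlgebroid I F A where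
  anchor x := L.anchor x ∘ₗ P.toFun x
  contMDiff_anchor X := L.contMDiff_anchor (P.app X)
  bracket := L.deformedBracket P
  bracket_add X Y Z := by
    simp only [deformedBracket, bracket_add, P.app_add]; abel
  bracket_skew := L.deformedBracket_skew P
  jacobi X Y Z := by
    have j : ∀ X Y Z, L.bracket X (L.bracket Y Z)
        = -L.bracket Z (L.bracket X Y) + L.bracket Y (L.bracket X Z) := fun X Y Z => by
      rw [L.jacobi, L.bracket_skew (L.bracket X Y) Z]
    rw [L.deformedBracket_skew P (L.deformedBracket P X Y)]
    simp only [hP.deformedBracket_deformedBracket]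
    rw [j (P.app X) (P.app Y) Z, j (P.app X) Y (P.app Z), j X (P.app Y) (P.app Z),
      j (P.app X) Y Z, j X (P.app Y) Z, j X Y (P.app Z), j X Y Z]
    simp only [P.app_add, P.app_neg]
    abel
  leibniz X Y f x := by
    have h1 := L.leibniz (P.app X) Y f x
    have h2 := L.leibniz X (P.app Y) f x
    have h3 := L.leibniz X Y f x
    have e : L.deformedBracket P X (Y.funSMul f) x
        = L.bracket (P.app X) (Y.funSMul f) x + L.bracket X ((P.app Y).funSMul f) x
          - P.toFun x (L.bracket X (Y.funSMul f) x) := by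
      rw [deformedBracket, P.app_funSMul]; rfl
    have e' : L.deformedBracket P X Y x
        = L.bracket (P.app X) Y x + L.bracket X (P.app Y) x
          - P.toFun x (L.bracket X Y x) := rfl
    rw [e, e', h1, h2, h3]
    simp only [map_add, map_smul, EndField.app_apply, smul_add, smul_sub, LinearMap.comp_apply]
    abel

theorem isDeformation_deform (P : EndField I F A) (hP : L.IsNijenhuis P) :
    L.IsDeformation (L.deform P hP) P :=
  ⟨fun _ => rfl, fun _ _ => rfl⟩

end LieAlgebroid

end DeformationAlgebroid

section GlobalSections

variable {E : Type*} [NormedAddCommGroup E] [NormedSpace ℝ E] [FiniteDimensional ℝ E]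
  {H : Type*} [TopologicalSpace H] {I : ModelWithCorners ℝ E H}
  {N : Type*} [TopologicalSpace N] [ChartedSpace H N] [IsManifold I ∞ N] [T2Space N]
  {F : Type*} [NormedAddCommGroup F] [NormedSpace ℝ F]
  {A : N → Type*} [TopologicalSpace (TotalSpace F A)]
  [∀ x, AddCommGroup (A x)] [∀ x, Module ℝ (A x)] [∀ x, TopologicalSpace (A x)]
  [FiberBundle F A] [VectorBundle ℝ F A] [ContMDiffVectorBundle ∞ F A I]

/-- A vector of the model fibre extends to a global section that is constant near `x` in the
preferred trivialization at `x`. -/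
theorem exists_section_eventually_eq_symm (x : N) (v : F) :
    ∃ X : Cₛ^∞⟮I; F, A⟯, ∀ᶠ y in 𝓝 x, X y = (trivializationAt F A x).symm y v := by
  set e := trivializationAt F A x with he
  have hx : e.baseSet ∈ 𝓝 x := e.open_baseSet.mem_nhds (mem_baseSet_trivializationAt F A x)
  obtain ⟨f, -, hf⟩ := ((SmoothBumpFunction.nhds_basis_tsupport (I := I) x).mem_iff).1 hx
  have hs : ContMDiffOn I (I.prod 𝓘(ℝ, F)) ∞
      (fun y => TotalSpace.mk' F y (e.symm y v)) e.baseSet := by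
    rw [e.contMDiffOn_section_baseSet_iff]
    refine (contMDiffOn_const (c := v)).congr fun y hy => ?_
    rw [e.apply_mk_symm hy]
  refine ⟨⟨_, ContMDiffOn.smul_section_of_tsupport f.contMDiff.contMDiffOn e.open_baseSet hf hs⟩,
    ?_⟩
  filter_upwards [f.eventuallyEq_one] with y hy
  change f y • e.symm y v = _
  rw [hy, Pi.one_apply, one_smul]

theorem exists_section_apply_eq (x : N) (v : A x) : ∃ X : Cₛ^∞⟮I; F, A⟯, X x = v := by
  obtain ⟨X, hX⟩ := exists_section_eventually_eq_symm (I := I) (F := F) (A := A) x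
    (trivializationAt F A x ⟨x, v⟩).2
  refine ⟨X, hX.self_of_nhds.trans ?_⟩
  exact (trivializationAt F A x).symm_apply_apply_mk (mem_baseSet_trivializationAt F A x) v

end GlobalSections

section MextDeriv

variable {E : Type*} [NormedAddCommGroup E] [NormedSpace ℝ E]
  {H : Type*} [TopologicalSpace H] {I : ModelWithCorners ℝ E H}
  {N : Type*} [TopologicalSpace N] [ChartedSpace H N] [IsManifold I ∞ N]

theorem differentiableAt_continuousAlternatingMap [FiniteDimensional ℝ E] {k : ℕ}
    {G : Type*} [NormedAddCommGroup G] [NormedSpace ℝ G]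
    {β : G → E [⋀^Fin k]→L[ℝ] ℝ} {y : G}
    (h : ∀ v : Fin k → E, DifferentiableAt ℝ (fun z => β z v) y) : DifferentiableAt ℝ β y := by
  let b := Module.finBasis ℝ E
  let ev : (E [⋀^Fin k]→L[ℝ] ℝ) →ₗ[ℝ] ((Fin k → Fin (Module.finrank ℝ E)) → ℝ) :=
    { toFun := fun α i => α (fun j => b (i j))
      map_add' := fun _ _ => rfl
      map_smul' := fun _ _ => rfl }
  have hev : Function.Injective ev := by
    intro α α' hα
    apply ContinuousAlternatingMap.toAlternatingMap_injective
    refine Module.Basis.ext_alternating b fun i _ => congrFun hα i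
  have : FiniteDimensional ℝ (E [⋀^Fin k]→L[ℝ] ℝ) := FiniteDimensional.of_injective ev hev
  obtain ⟨g, hg⟩ := ev.exists_leftInverse_of_injective (LinearMap.ker_eq_bot.2 hev)
  have h1 : DifferentiableAt ℝ (fun z => ev (β z)) y :=
    differentiableAt_pi.2 fun i => h _
  have h2 := (LinearMap.toContinuousLinearMap g).differentiableAt.comp y h1
  refine h2.congr_of_eventuallyEq (Filter.Eventually.of_forall fun z => ?_)
  exact (LinearMap.congr_fun hg (β z)).symm

/-- The expression of a form in the preferred chart at `x`. -/
def formInChart (I : ModelWithCorners ℝ E H) {k : ℕ}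
    (α : ∀ x : N, TangentSpace I x [⋀^Fin k]→L[ℝ] ℝ) (x : N)
    (y : E) : E [⋀^Fin k]→L[ℝ] ℝ :=
  (α ((extChartAt I x).symm y)).compContinuousLinearMap
      (mfderivWithin 𝓘(ℝ, E) I (extChartAt I x).symm (range I) y)

theorem differentiableAt_formInChart [I.Boundaryless] [FiniteDimensional ℝ E] [T2Space N] {k : ℕ}
    {α : ∀ x : N, TangentSpace I x [⋀^Fin k]→L[ℝ] ℝ}
    (hα : α ∈ smoothForms I E (fun x : N => TangentSpace I x) k) (x : N) :
    DifferentiableAt ℝ (formInChart I α x) (extChartAt I x x) := by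
  refine differentiableAt_continuousAlternatingMap fun v => ?_
  choose X hX using fun i => exists_section_eventually_eq_symm (I := I) (F := E)
    (A := fun x : N => TangentSpace I x) x (v i)
  have h1 := ((hα X).contMDiffAt (x := x))
  have h2 : ContMDiffAt 𝓘(ℝ, E) 𝓘(ℝ, ℝ) ∞ ((fun z => α z (fun i => X i z)) ∘ (extChartAt I x).symm)
      (extChartAt I x x) := by
    refine ContMDiffAt.comp _ ?_ ?_ (I' := I)
    · rw [extChartAt_to_inv]; exact h1
    · have := contMDiffWithinAt_extChartAt_symm_range_self (I := I) (n := ∞) x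
      rwa [I.range_eq_univ, contMDiffWithinAt_univ] at this
  have h3 := h2.contDiffAt.differentiableAt (by simp)
  refine h3.congr_of_eventuallyEq ?_
  have h4 : ∀ᶠ z in 𝓝 x, z ∈ (chartAt H x).source ∧
      ∀ i, X i z = (trivializationAt E (TangentSpace I) x).symm z (v i) :=
    Filter.Eventually.and ((chartAt H x).open_source.mem_nhds (mem_chart_source H x))
      (Filter.eventually_all.2 hX)
  have h5 : Filter.Tendsto (extChartAt I x).symm (𝓝 (extChartAt I x x)) (𝓝 x) := by
    simpa using (continuousAt_extChartAt_symm (I := I) x).tendsto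
  filter_upwards [h5.eventually h4, extChartAt_target_mem_nhds (I := I) x] with y hy hy'
  change α _ _ = α _ _
  congr 1
  ext i
  rw [hy.2 i]
  have := TangentBundle.symmL_trivializationAt (I := I) hy.1
  have h6 := congrArg (fun T => T (v i)) this
  rw [(extChartAt I x).right_inv hy'] at h6
  refine h6.symm.trans ?_
  exact Trivialization.symmL_apply _ (by simpa using hy.1) _

theorem mvfderiv_eq_fderivWithin_comp_extChartAt_symm {g : N → ℝ} {x : N}
    (hg : MDifferentiableAt I 𝓘(ℝ, ℝ) g x) (v : TangentSpace I x) :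
    mvfderiv I g x v
      = fderivWithin ℝ (g ∘ (extChartAt I x).symm) (range I) (extChartAt I x x) v := by
  have h : mfderiv I 𝓘(ℝ, ℝ) g x
      = fderivWithin ℝ (writtenInExtChartAt I 𝓘(ℝ, ℝ) x g) (range I) (extChartAt I x x) := by
    unfold mfderiv
    exact if_pos hg
  exact congrArg (fun T => T v) h

/-- The expression of a vector field in the preferred chart at `x`. -/
def fieldInChart (I : ModelWithCorners ℝ E H) (X : ∀ x : N, TangentSpace I x) (x : N) : E → E :=
  mpullbackWithin 𝓘(ℝ, E) I (extChartAt I x).symm X (range I)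

theorem mfderivWithin_fieldInChart (X : ∀ x : N, TangentSpace I x) (x : N) {y : E}
    (hy : y ∈ (extChartAt I x).target) :
    mfderivWithin 𝓘(ℝ, E) I (extChartAt I x).symm (range I) y
        (fieldInChart (E := E) I X x y)
      = X ((extChartAt I x).symm y) := by
  have h := isInvertible_mfderivWithin_extChartAt_symm (I := I) hy
  obtain ⟨e, he⟩ := h
  have h1 : fieldInChart (E := E) I X x y = e.symm (X ((extChartAt I x).symm y)) := by
    change (mfderivWithin 𝓘(ℝ, E) I (extChartAt I x).symm (range I) y).inverse _ = _
    rw [← he, ContinuousLinearMap.inverse_equiv]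
    rfl
  rw [h1, ← he]
  exact e.apply_symm_apply _

theorem formInChart_self {k : ℕ} (α : ∀ x : N, TangentSpace I x [⋀^Fin k]→L[ℝ] ℝ) (x : N) :
    formInChart I α x (extChartAt I x x) = α x := by
  have h : ∀ (y : N) (_ : y = x) (T : E →L[ℝ] E), T = ContinuousLinearMap.id ℝ E →
      ((α y : E [⋀^Fin k]→L[ℝ] ℝ).compContinuousLinearMap T : E [⋀^Fin k]→L[ℝ] ℝ) = α x := by
    rintro y rfl T rfl
    rfl
  exact h _ (extChartAt_to_inv x) _ mfderivWithin_range_extChartAt_symm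

theorem fieldInChart_self (X : ∀ x : N, TangentSpace I x) (x : N) :
    fieldInChart I X x (extChartAt I x x) = X x := by
  have h : ∀ (y : N) (_ : y = x) (T : E →L[ℝ] E), T = ContinuousLinearMap.id ℝ E →
      T.inverse (X y) = X x := by
    rintro y rfl T rfl
    rw [ContinuousLinearMap.inverse_id]
    rfl
  exact h _ (extChartAt_to_inv x) _ mfderivWithin_range_extChartAt_symm

variable [CompleteSpace E]

theorem differentiableWithinAt_fieldInChart {X : ∀ x : N, TangentSpace I x} {x : N}
    (hX : MDifferentiableAt I I.tangent (fun x => (⟨x, X x⟩ : TangentBundle I N)) x) :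
    DifferentiableWithinAt ℝ (fieldInChart I X x) (range I) (extChartAt I x x) := by
  have : IsManifold I 2 N := inferInstance
  have h := MDifferentiableWithinAt.differentiableWithinAt_mpullbackWithin_vectorField
    (s := univ) hX.mdifferentiableWithinAt
  rwa [preimage_univ, univ_inter] at h

theorem lieBracketWithin_fieldInChart (X Y : ∀ x : N, TangentSpace I x) (x : N) :
    lieBracketWithin ℝ (fieldInChart I X x) (fieldInChart I Y x) (range I) (extChartAt I x x)
      = mlieBracket I X Y x := by
  have h : ∀ (T : E →L[ℝ] E) (v : E), T = ContinuousLinearMap.id ℝ E → v = T.inverse v := by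
    rintro T v rfl
    rw [ContinuousLinearMap.inverse_id]
    rfl
  refine (h _ _ (mfderiv_extChartAt_self (I := I) (x := x))).trans ?_
  rw [mlieBracket, mlieBracketWithin_apply, preimage_univ, univ_inter]
  rfl

theorem mextDeriv_apply_vectorField {k : ℕ}
    {α : ∀ x : N, TangentSpace I x [⋀^Fin (k + 1)]→L[ℝ] ℝ} {x : N}
    (hα : DifferentiableWithinAt ℝ (formInChart I α x) (range I) (extChartAt I x x))
    {X : Fin (k + 2) → ∀ x : N, TangentSpace I x}
    (hX : ∀ i, MDifferentiableAt I I.tangent (fun x => (⟨x, X i x⟩ : TangentBundle I N)) x)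
    (hαX : ∀ i, MDifferentiableAt I 𝓘(ℝ, ℝ)
      (fun z => α z (Fin.removeNth i (fun j => X j z))) x) :
    mextDeriv I α x (fun i => X i x) =
      (∑ i : Fin (k + 2), (-1) ^ i.val •
          mvfderiv I (fun z => α z (Fin.removeNth i (fun j => X j z))) x (X i x)) -
        ∑ i : Fin (k + 1), ∑ j ≥ i,
          (-1) ^ (i + j : ℕ) •
            α x (Matrix.vecCons (mlieBracket I (X i.castSucc) (X j.succ) x)
              (j.removeNth (i.castSucc.removeNth (fun j => X j x)))) := by
  have h1 : mextDeriv I α x (fun i => X i x)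
      = extDerivWithin (formInChart I α x) (range I) (extChartAt I x x)
        (fun i => fieldInChart I (X i) x (extChartAt I x x)) := by
    simp only [fieldInChart_self]
    rw [mextDeriv, mfderiv_extChartAt_self]
    rfl
  have hf : ∀ y ∈ (extChartAt I x).target, ∀ v : Fin (k + 1) → ∀ x : N, TangentSpace I x,
      formInChart I α x y (fun j => fieldInChart I (v j) x y)
        = α ((extChartAt I x).symm y) (fun j => v j ((extChartAt I x).symm y)) := by
    intro y hy v
    refine congrArg (α ((extChartAt I x).symm y)) (funext fun j => ?_)
    exact mfderivWithin_fieldInChart (v j) x hy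
  rw [h1, extDerivWithin_apply_vectorField hα
    (fun i => differentiableWithinAt_fieldInChart (hX i)) I.uniqueDiffWithinAt_image]
  simp only [lieBracketWithin_fieldInChart, fieldInChart_self]
  congr 1
  · refine Finset.sum_congr rfl fun i _ => ?_
    rw [mvfderiv_eq_fderivWithin_comp_extChartAt_symm (hαX i)]
    congr 2
    refine Filter.EventuallyEq.fderivWithin_eq_of_mem ?_ (mem_range_self _)
    filter_upwards [extChartAt_target_mem_nhdsWithin (I := I) x] with y hy
    exact hf y hy (i.removeNth X)
  · refine Finset.sum_congr rfl fun i _ => Finset.sum_congr rfl fun j _ => ?_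
    rw [formInChart_self]
    rfl

end MextDeriv

section Derivations

variable {E : Type*} [NormedAddCommGroup E] [NormedSpace ℝ E]
  {H : Type*} [TopologicalSpace H] {I : ModelWithCorners ℝ E H}
  {N : Type*} [TopologicalSpace N] [ChartedSpace H N] [IsManifold I ∞ N]
  {F : Type*} [NormedAddCommGroup F] [NormedSpace ℝ F]
  {A : N → Type*} [TopologicalSpace (TotalSpace F A)]
  [∀ x, AddCommGroup (A x)] [∀ x, Module ℝ (A x)] [∀ x, TopologicalSpace (A x)]
  [FiberBundle F A] [VectorBundle ℝ F A]

theorem contMDiff_mvfderiv_apply {f : N → ℝ} (hf : ContMDiff I 𝓘(ℝ, ℝ) ∞ f)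
    (X : Cₛ^∞⟮I; E, (fun x : N => TangentSpace I x)⟯) :
    ContMDiff I 𝓘(ℝ, ℝ) ∞ (fun x => mvfderiv I f x (X x)) := by
  have h1 : ContMDiff I.tangent 𝓘(ℝ, ℝ).tangent ∞ (tangentMap I 𝓘(ℝ, ℝ) f) :=
    hf.contMDiff_tangentMap (by simp)
  exact (contMDiff_snd_tangentBundle_modelSpace ℝ 𝓘(ℝ, ℝ)).comp (h1.comp X.contMDiff)

namespace LieAlgebroid

variable (L : LieAlgebroid I F A)

theorem contMDiff_der (X : Cₛ^∞⟮I; F, A⟯) {f : N → ℝ} (hf : ContMDiff I 𝓘(ℝ, ℝ) ∞ f) :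
    ContMDiff I 𝓘(ℝ, ℝ) ∞ (L.der X f) :=
  contMDiff_mvfderiv_apply hf (L.anchorSection X)

theorem der_const (X : Cₛ^∞⟮I; F, A⟯) (c : ℝ) (x : N) : L.der X (fun _ => c) x = 0 := by
  rw [der, mvfderiv_const]; rfl

theorem der_add (X : Cₛ^∞⟮I; F, A⟯) {f g : N → ℝ} (hf : ContMDiff I 𝓘(ℝ, ℝ) ∞ f)
    (hg : ContMDiff I 𝓘(ℝ, ℝ) ∞ g) (x : N) :
    L.der X (fun y => f y + g y) x = L.der X f x + L.der X g x :=
  congrArg (fun T => T (L.anchor x (X x)))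
    (mvfderiv_add ((hf x).mdifferentiableAt (by simp)) ((hg x).mdifferentiableAt (by simp)))

theorem der_neg (X : Cₛ^∞⟮I; F, A⟯) (f : N → ℝ) (x : N) :
    L.der X (fun y => -f y) x = -L.der X f x :=
  congrArg (fun T => T (L.anchor x (X x))) (mvfderiv_neg (g := f))

theorem der_sub (X : Cₛ^∞⟮I; F, A⟯) {f g : N → ℝ} (hf : ContMDiff I 𝓘(ℝ, ℝ) ∞ f)
    (hg : ContMDiff I 𝓘(ℝ, ℝ) ∞ g) (x : N) :
    L.der X (fun y => f y - g y) x = L.der X f x - L.der X g x :=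
  congrArg (fun T => T (L.anchor x (X x)))
    (mvfderiv_sub ((hf x).mdifferentiableAt (by simp)) ((hg x).mdifferentiableAt (by simp)))

theorem der_mul (X : Cₛ^∞⟮I; F, A⟯) {f g : N → ℝ} (hf : ContMDiff I 𝓘(ℝ, ℝ) ∞ f)
    (hg : ContMDiff I 𝓘(ℝ, ℝ) ∞ g) (x : N) :
    L.der X (fun y => f y * g y) x = f x * L.der X g x + L.der X f x * g x := by
  refine (congrArg (fun T => T (L.anchor x (X x)))
    (mvfderiv_mul ((hf x).mdifferentiableAt (by simp))
      ((hg x).mdifferentiableAt (by simp)))).trans ?_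
  change f x * L.der X g x + g x * L.der X f x = _
  ring

theorem der_sum {ι : Type*} (s : Finset ι) (X : Cₛ^∞⟮I; F, A⟯) {f : ι → N → ℝ}
    (hf : ∀ i, ContMDiff I 𝓘(ℝ, ℝ) ∞ (f i)) (x : N) :
    L.der X (fun y => ∑ i ∈ s, f i y) x = ∑ i ∈ s, L.der X (f i) x := by
  classical
  induction s using Finset.induction_on with
  | empty => simpa using L.der_const X 0 x
  | insert a s ha ih =>
    simp only [Finset.sum_insert ha]
    rw [L.der_add X (hf a) (contMDiff_finsetSum fun i _ => hf i), ih]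

theorem der_congr (X : Cₛ^∞⟮I; F, A⟯) {f g : N → ℝ} {x : N} (h : f =ᶠ[𝓝 x] g) :
    L.der X f x = L.der X g x :=
  congrArg (fun T : TangentSpace I x →L[ℝ] ℝ => T (L.anchor x (X x)))
    (show mvfderiv I f x = mvfderiv I g x by
      ext v
      have := h.mfderiv_eq (I := I) (I' := 𝓘(ℝ, ℝ))
      exact congrArg (fun T : E →L[ℝ] ℝ => T v) this)

/-- The smooth function `ρ(X) f`. -/
def derMap (X : Cₛ^∞⟮I; F, A⟯) (f : C^∞⟮I, N; 𝓘(ℝ, ℝ), ℝ⟯) : C^∞⟮I, N; 𝓘(ℝ, ℝ), ℝ⟯ :=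
  ⟨L.der X f, L.contMDiff_der X f.contMDiff⟩

theorem bracket_funSMul (X Y : Cₛ^∞⟮I; F, A⟯) (f : C^∞⟮I, N; 𝓘(ℝ, ℝ), ℝ⟯) :
    L.bracket X (Y.funSMul f) = (L.bracket X Y).funSMul f
      + Y.funSMul (L.derMap X f) := by
  ext x
  exact L.leibniz X Y f x

theorem der_bracket_smul (X Y Z : Cₛ^∞⟮I; F, A⟯) {f : N → ℝ} (hf : ContMDiff I 𝓘(ℝ, ℝ) ∞ f)
    (x : N) :
    (L.der (L.bracket X Y) f x - (L.der X (L.der Y f) x - L.der Y (L.der X f) x)) • Z x = 0 := by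
  let f' : C^∞⟮I, N; 𝓘(ℝ, ℝ), ℝ⟯ := ⟨f, hf⟩
  have h := congrArg (fun S => S x) (L.jacobi X Y (Z.funSMul f'))
  have h' := congrArg (fun S => S x) (L.jacobi X Y Z)
  simp only [bracket_funSMul, L.bracket_add, ContMDiffSection.coe_add, Pi.add_apply,
    ContMDiffSection.funSMul_apply] at h h'
  rw [h'] at h
  change _ + L.der X f x • _ + (L.der Y f x • _ + L.der X (L.der Y f) x • Z x)
    = _ + L.der (L.bracket X Y) f x • Z x + (_ + L.der Y f x • _ + (L.der X f x • _ +
      L.der Y (L.der X f) x • Z x)) at h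
  rw [sub_smul, sub_smul, ← sub_eq_zero.2 h.symm]
  module

end LieAlgebroid

end Derivations

section TangentCalculus

variable {E : Type*} [NormedAddCommGroup E] [NormedSpace ℝ E] [FiniteDimensional ℝ E]
  {H : Type*} [TopologicalSpace H] {I : ModelWithCorners ℝ E H}
  {N : Type*} [TopologicalSpace N] [ChartedSpace H N] [IsManifold I ∞ N] [T2Space N]

theorem tangentLieAlgebroid_bracket_apply
    (X Y : Cₛ^∞⟮I; E, (fun x : N => TangentSpace I x)⟯) (x : N) :
    (tangentLieAlgebroid I N).bracket X Y x = mlieBracket I X Y x := rfl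

theorem tangentLieAlgebroid_der_apply
    (X : Cₛ^∞⟮I; E, (fun x : N => TangentSpace I x)⟯) (f : N → ℝ) (x : N) :
    (tangentLieAlgebroid I N).der X f x = mvfderiv I f x (X x) := rfl

theorem tangentLieAlgebroid_der_bracket [Nontrivial E]
    (X Y : Cₛ^∞⟮I; E, (fun x : N => TangentSpace I x)⟯) {f : N → ℝ}
    (hf : ContMDiff I 𝓘(ℝ, ℝ) ∞ f) (x : N) :
    (tangentLieAlgebroid I N).der ((tangentLieAlgebroid I N).bracket X Y) f x
      = (tangentLieAlgebroid I N).der X ((tangentLieAlgebroid I N).der Y f) x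
        - (tangentLieAlgebroid I N).der Y ((tangentLieAlgebroid I N).der X f) x := by
  obtain ⟨v, hv⟩ := exists_ne (0 : E)
  obtain ⟨Z, hZ⟩ := exists_section_apply_eq (I := I) (F := E)
    (A := fun x : N => TangentSpace I x) x v
  have h := (tangentLieAlgebroid I N).der_bracket_smul X Y Z hf x
  rw [hZ] at h
  exact sub_eq_zero.1 ((smul_eq_zero.1 h).resolve_right hv)

theorem mextDeriv_one_apply [I.Boundaryless]
    {θ : ∀ x : N, TangentSpace I x [⋀^Fin 1]→L[ℝ] ℝ}
    (hθ : θ ∈ smoothForms I E (fun x : N => TangentSpace I x) 1)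
    (X Y : Cₛ^∞⟮I; E, (fun x : N => TangentSpace I x)⟯) (x : N) :
    mextDeriv I θ x ![X x, Y x] =
      (tangentLieAlgebroid I N).der X (fun y => θ y ![Y y]) x
        - (tangentLieAlgebroid I N).der Y (fun y => θ y ![X y]) x
        - θ x ![(tangentLieAlgebroid I N).bracket X Y x] := by
  have h := mextDeriv_apply_vectorField (k := 0) (α := θ) (x := x)
    (differentiableAt_formInChart hθ x).differentiableWithinAt
    (X := fun i => (![X, Y] i : Cₛ^∞⟮I; E, (fun x : N => TangentSpace I x)⟯))
    (fun i => ((![X, Y] i).contMDiff x).mdifferentiableAt (by simp))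
    (fun i => ((hθ (fun j => Fin.removeNth i ![X, Y] j)) x).mdifferentiableAt (by simp))
  have e : (fun i => (![X, Y] i : Cₛ^∞⟮I; E, (fun x : N => TangentSpace I x)⟯) x)
      = ![X x, Y x] := by
    ext i; fin_cases i <;> rfl
  rw [e] at h
  have e0 : (fun z => θ z (Fin.removeNth 0
      (fun j => (![X, Y] j : Cₛ^∞⟮I; E, (fun x : N => TangentSpace I x)⟯) z)))
      = fun z => θ z ![Y z] :=
    funext fun z => congrArg (θ z) (by ext i; fin_cases i; rfl)
  have e1 : (fun z => θ z (Fin.removeNth 1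
      (fun j => (![X, Y] j : Cₛ^∞⟮I; E, (fun x : N => TangentSpace I x)⟯) z)))
      = fun z => θ z ![X z] :=
    funext fun z => congrArg (θ z) (by ext i; fin_cases i; rfl)
  rw [h, Fin.sum_univ_two, e0, e1]
  simp [tangentLieAlgebroid_der_apply, tangentLieAlgebroid_bracket_apply, sub_eq_add_neg]

theorem mextDeriv_two_apply [I.Boundaryless]
    {τ : ∀ x : N, TangentSpace I x [⋀^Fin 2]→L[ℝ] ℝ}
    (hτ : τ ∈ smoothForms I E (fun x : N => TangentSpace I x) 2)
    (X Y Z : Cₛ^∞⟮I; E, (fun x : N => TangentSpace I x)⟯) (x : N) :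
    mextDeriv I τ x ![X x, Y x, Z x] =
      (tangentLieAlgebroid I N).der X (fun y => τ y ![Y y, Z y]) x
        - (tangentLieAlgebroid I N).der Y (fun y => τ y ![X y, Z y]) x
        + (tangentLieAlgebroid I N).der Z (fun y => τ y ![X y, Y y]) x
        - τ x ![(tangentLieAlgebroid I N).bracket X Y x, Z x]
        + τ x ![(tangentLieAlgebroid I N).bracket X Z x, Y x]
        - τ x ![(tangentLieAlgebroid I N).bracket Y Z x, X x] := by
  have h := mextDeriv_apply_vectorField (k := 1) (α := τ) (x := x)
    (differentiableAt_formInChart hτ x).differentiableWithinAt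
    (X := fun i => (![X, Y, Z] i : Cₛ^∞⟮I; E, (fun x : N => TangentSpace I x)⟯))
    (fun i => ((![X, Y, Z] i).contMDiff x).mdifferentiableAt (by simp))
    (fun i => ((hτ (fun j => Fin.removeNth i ![X, Y, Z] j)) x).mdifferentiableAt (by simp))
  have e : (fun i => (![X, Y, Z] i : Cₛ^∞⟮I; E, (fun x : N => TangentSpace I x)⟯) x)
      = ![X x, Y x, Z x] := by
    ext i; fin_cases i <;> rfl
  rw [e] at h
  have e0 : (fun z => τ z (Fin.removeNth 0
      (fun j => (![X, Y, Z] j : Cₛ^∞⟮I; E, (fun x : N => TangentSpace I x)⟯) z)))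
      = fun z => τ z ![Y z, Z z] :=
    funext fun z => congrArg (τ z) (by ext i; fin_cases i <;> rfl)
  have e1 : (fun z => τ z (Fin.removeNth 1
      (fun j => (![X, Y, Z] j : Cₛ^∞⟮I; E, (fun x : N => TangentSpace I x)⟯) z)))
      = fun z => τ z ![X z, Z z] :=
    funext fun z => congrArg (τ z) (by ext i; fin_cases i <;> rfl)
  have e2 : (fun z => τ z (Fin.removeNth 2
      (fun j => (![X, Y, Z] j : Cₛ^∞⟮I; E, (fun x : N => TangentSpace I x)⟯) z)))
      = fun z => τ z ![X z, Y z] :=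
    funext fun z => congrArg (τ z) (by ext i; fin_cases i <;> rfl)
  have r1 : (Fin.removeNth 1 ![Y x, Z x] : Fin 1 → TangentSpace I x) = ![Y x] := by
    ext i; fin_cases i; rfl
  have r2 : (Fin.removeNth 1 (Fin.removeNth 1 ![X x, Y x, Z x]) : Fin 1 → TangentSpace I x)
      = ![X x] := by
    ext i; fin_cases i; rfl
  have s1 : Finset.Ici (1 : Fin 2) = {1} := by decide
  rw [h, Fin.sum_univ_three, e0, e1, e2]
  simp [Fin.sum_univ_two, tangentLieAlgebroid_der_apply, tangentLieAlgebroid_bracket_apply,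
    sub_eq_add_neg, s1, r1, r2]
  ring

end TangentCalculus

section TwoForms

variable {V : Type*} [AddCommGroup V] [Module ℝ V] [TopologicalSpace V]

theorem flat_apply (α : V [⋀^Fin 2]→L[ℝ] ℝ) (X Y : V) : flat α X Y = -α ![X, Y] := rfl

namespace ContinuousAlternatingMap

theorem two_apply_eq_neg_flat (α : V [⋀^Fin 2]→L[ℝ] ℝ) (X Y : V) : α ![X, Y] = -flat α X Y := by
  rw [flat_apply, neg_neg]

theorem two_self (α : V [⋀^Fin 2]→L[ℝ] ℝ) (X : V) : α ![X, X] = 0 :=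
  α.map_eq_zero_of_eq ![X, X] (i := 0) (j := 1) rfl (by decide)

theorem two_add_left (α : V [⋀^Fin 2]→L[ℝ] ℝ) (X X' Y : V) :
    α ![X + X', Y] = α ![X, Y] + α ![X', Y] := by
  simp only [two_apply_eq_neg_flat, map_add, LinearMap.add_apply]; ring

theorem two_add_right (α : V [⋀^Fin 2]→L[ℝ] ℝ) (X Y Y' : V) :
    α ![X, Y + Y'] = α ![X, Y] + α ![X, Y'] := by
  simp only [two_apply_eq_neg_flat, map_add]; ring

theorem two_smul_left (α : V [⋀^Fin 2]→L[ℝ] ℝ) (c : ℝ) (X Y : V) :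
    α ![c • X, Y] = c * α ![X, Y] := by
  simp only [two_apply_eq_neg_flat, map_smul, LinearMap.smul_apply, smul_eq_mul]; ring

theorem two_smul_right (α : V [⋀^Fin 2]→L[ℝ] ℝ) (c : ℝ) (X Y : V) :
    α ![X, c • Y] = c * α ![X, Y] := by
  simp only [two_apply_eq_neg_flat, map_smul, smul_eq_mul]; ring

theorem two_swap (α : V [⋀^Fin 2]→L[ℝ] ℝ) (X Y : V) : α ![Y, X] = -α ![X, Y] := by
  have h := α.two_self (X + Y)
  rw [two_add_left, two_add_right, two_add_right, two_self, two_self] at h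
  linarith

end ContinuousAlternatingMap

open ContinuousAlternatingMap

/-- The exterior product of two `2`-forms as a `4`-form. -/
def wedgeForm (α β : V [⋀^Fin 2]→L[ℝ] ℝ) : V [⋀^Fin 4]→L[ℝ] ℝ where
  toFun := wedge α β
  map_update_add' := by
    intro inst m i x y
    obtain rfl : inst = instDecidableEqFin 4 := Subsingleton.elim _ _
    fin_cases i <;> simp [wedge, two_add_left, two_add_right] <;> ring
  map_update_smul' := by
    intro inst m i c x
    obtain rfl : inst = instDecidableEqFin 4 := Subsingleton.elim _ _
    fin_cases i <;> simp [wedge, two_smul_left, two_smul_right] <;> ring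
  cont := by
    have h : ∀ (γ : V [⋀^Fin 2]→L[ℝ] ℝ) (i j : Fin 4),
        Continuous fun v : Fin 4 → V => γ ![v i, v j] := fun γ i j =>
      γ.cont.comp (continuous_pi fun k => by fin_cases k <;> exact continuous_apply _)
    change Continuous fun v => wedge α β v
    unfold wedge
    have := h α
    have := h β
    fun_prop
  map_eq_zero_of_eq' := by
    intro v i j h hij
    have s : ∀ γ : V [⋀^Fin 2]→L[ℝ] ℝ, γ ![v 1, v 0] = -γ ![v 0, v 1] ∧
        γ ![v 2, v 0] = -γ ![v 0, v 2] ∧ γ ![v 3, v 0] = -γ ![v 0, v 3] ∧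
        γ ![v 2, v 1] = -γ ![v 1, v 2] ∧ γ ![v 3, v 1] = -γ ![v 1, v 3] ∧
        γ ![v 3, v 2] = -γ ![v 2, v 3] := fun γ =>
      ⟨γ.two_swap _ _, γ.two_swap _ _, γ.two_swap _ _, γ.two_swap _ _, γ.two_swap _ _,
        γ.two_swap _ _⟩
    change wedge α β v = 0
    fin_cases i <;> fin_cases j <;> first | exact absurd rfl hij | skip
    all_goals
      simp only [Fin.zero_eta, Fin.mk_one, Fin.reduceFinMk] at h
      simp only [wedge, h, two_self, s]
      ring

theorem wedgeForm_apply (α β : V [⋀^Fin 2]→L[ℝ] ℝ) (v : Fin 4 → V) :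
    wedgeForm α β v = wedge α β v := rfl

theorem wedge_self_apply (α : V [⋀^Fin 2]→L[ℝ] ℝ) (v : Fin 4 → V) :
    wedge α α v = 2 * (α ![v 0, v 1] * α ![v 2, v 3] - α ![v 0, v 2] * α ![v 1, v 3]
      + α ![v 0, v 3] * α ![v 1, v 2]) := by
  rw [wedge]; ring

theorem wedge_smul_smul (c : ℝ) (α : V [⋀^Fin 2]→L[ℝ] ℝ) :
    wedge (c • α) (c • α) = c ^ 2 • wedge α α := by
  ext v
  simp only [wedge, ContinuousAlternatingMap.smul_apply, Pi.smul_apply, smul_eq_mul]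
  ring

theorem wedge_smul_left (c : ℝ) (α β : V [⋀^Fin 2]→L[ℝ] ℝ) :
    wedge (c • α) β = c • wedge α β := by
  ext v
  simp only [wedge, ContinuousAlternatingMap.smul_apply, Pi.smul_apply, smul_eq_mul]
  ring

theorem pfaffian_smul_wedge {τ α : V [⋀^Fin 2]→L[ℝ] ℝ} (h : pfaffian τ α ≠ 0) :
    pfaffian τ α • wedge τ τ = wedge α α := by
  unfold pfaffian at h ⊢
  split_ifs at h ⊢ with h'
  · exact h'.choose_spec
  · exact absurd rfl h

/-- A `2`-form is non-degenerate if `i_X τ = 0` only for `X = 0`. -/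
def IsNondegenerate (τ : V [⋀^Fin 2]→L[ℝ] ℝ) : Prop := ∀ X, (∀ Y, τ ![X, Y] = 0) → X = 0

theorem IsNondegenerate.ext {τ : V [⋀^Fin 2]→L[ℝ] ℝ} (h : IsNondegenerate τ) {X X' : V}
    (hX : ∀ Y, τ ![X, Y] = τ ![X', Y]) : X = X' := by
  refine sub_eq_zero.1 (h _ fun Y => ?_)
  have := hX Y
  simp only [two_apply_eq_neg_flat] at this ⊢
  rw [map_sub, LinearMap.sub_apply]
  linarith

theorem IsNondegenerate.apply_inverseSharp_flat [FiniteDimensional ℝ V]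
    {τ : V [⋀^Fin 2]→L[ℝ] ℝ} (h : IsNondegenerate τ) (α : V [⋀^Fin 2]→L[ℝ] ℝ) (X Y : V) :
    τ ![(inverseSharp τ ∘ₗ flat α) X, Y] = α ![X, Y] := by
  have hinj : Function.Injective (flat τ) := fun X X' hX =>
    h.ext fun Y => by rw [two_apply_eq_neg_flat, two_apply_eq_neg_flat, hX]
  have hb : Function.Bijective (flat τ) :=
    ⟨hinj, (LinearMap.injective_iff_surjective_of_finrank_eq_finrank
      Subspace.dual_finrank_eq.symm).1 hinj⟩
  rw [two_apply_eq_neg_flat, two_apply_eq_neg_flat, LinearMap.comp_apply, inverseSharp, dif_pos hb]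
  congr 2
  exact (LinearEquiv.ofBijective (flat τ) hb).apply_symm_apply (flat α X)

theorem IsNondegenerate.exists_orthogonal [FiniteDimensional ℝ V] (hV : Module.finrank ℝ V = 4)
    (τ : V [⋀^Fin 2]→L[ℝ] ℝ) (U W : V) : ∃ Z ≠ 0, τ ![U, Z] = 0 ∧ τ ![W, Z] = 0 := by
  have h := LinearMap.ker_ne_bot_of_finrank_lt (f := (flat τ U).prod (flat τ W)) (by simp [hV])
  obtain ⟨Z, hZ, hZ0⟩ := (Submodule.ne_bot_iff _).1 h
  refine ⟨Z, hZ0, ?_⟩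
  have hZ' : (flat τ U Z, flat τ W Z) = (0, 0) := hZ
  rw [two_apply_eq_neg_flat, two_apply_eq_neg_flat]
  simpa using hZ'

theorem IsNondegenerate.exists_apply_eq_one {τ : V [⋀^Fin 2]→L[ℝ] ℝ} (h : IsNondegenerate τ)
    {X : V} (hX : X ≠ 0) : ∃ Y, τ ![X, Y] = 1 := by
  by_contra! hY
  refine hX (h X fun Y => by_contra fun h0 => hY ((τ ![X, Y])⁻¹ • Y) ?_)
  rw [two_smul_right, inv_mul_cancel₀ h0]

theorem IsNondegenerate.wedge_self_ne_zero [FiniteDimensional ℝ V]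
    (hV : Module.finrank ℝ V = 4) {τ : V [⋀^Fin 2]→L[ℝ] ℝ} (h : IsNondegenerate τ) :
    wedge τ τ ≠ 0 := by
  intro h0
  have : Nontrivial V := Module.nontrivial_of_finrank_pos (R := ℝ) (by omega)
  obtain ⟨U, hU⟩ := exists_ne (0 : V)
  obtain ⟨W, hW⟩ := h.exists_apply_eq_one hU
  obtain ⟨Z, hZ, h1, h2⟩ := IsNondegenerate.exists_orthogonal hV τ U W
  obtain ⟨T, hT⟩ := h.exists_apply_eq_one hZ
  have := congrFun h0 ![U, W, Z, T]
  rw [wedge_self_apply] at this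
  simp [hW, h1, h2, hT] at this

/-- In dimension `4`, the endomorphism `A` with `τ(A X, Y) = α(X, Y)` and `α ∧ τ = 0`,
`α ∧ α = c τ ∧ τ`, satisfies `A² = -c`. -/
theorem IsNondegenerate.apply_apply_eq [FiniteDimensional ℝ V]
    (hV : Module.finrank ℝ V = 4) {τ α : V [⋀^Fin 2]→L[ℝ] ℝ} (h : IsNondegenerate τ)
    {A : V →ₗ[ℝ] V} (hA : ∀ X Y, τ ![A X, Y] = α ![X, Y]) (hατ : wedge α τ = 0) {c : ℝ}
    (hαα : c • wedge τ τ = wedge α α) (X : V) : A (A X) = -c • X := by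
  set T := A (A X) + c • X with hT
  suffices T = 0 by rw [neg_smul]; exact eq_neg_of_add_eq_zero_left this
  by_contra hT0
  have key : ∀ Y Z W, τ ![T, Y] * τ ![Z, W] - τ ![T, Z] * τ ![Y, W] + τ ![T, W] * τ ![Y, Z]
      = 0 := by
    intro Y Z W
    have h1 := congrFun hατ ![A X, Y, Z, W]
    have h2 := congrFun hαα ![X, Y, Z, W]
    rw [Pi.smul_apply, wedge_self_apply, wedge_self_apply] at h2
    simp only [wedge, Matrix.cons_val_zero, Matrix.cons_val_one, Matrix.cons_val, Pi.zero_apply,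
      smul_eq_mul, hA] at h1 h2
    simp only [hT, two_add_left, two_smul_left, hA]
    linear_combination h1 + h2 / 2
  obtain ⟨U, hU⟩ := h.exists_apply_eq_one hT0
  obtain ⟨Z, hZ, h1, h2⟩ := IsNondegenerate.exists_orthogonal hV τ T U
  refine hZ (h Z fun W => ?_)
  have := key U Z W
  rw [hU, h1, h2] at this
  linarith

theorem sum_wedge_self_update_eq_zero {τ α : V [⋀^Fin 2]→L[ℝ] ℝ}
    {A : V →ₗ[ℝ] V} (hA : ∀ X Y, τ ![A X, Y] = α ![X, Y]) (hατ : wedge α τ = 0)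
    (v : Fin 4 → V) : ∑ i, wedge τ τ (Function.update v i (A (v i))) = 0 := by
  have hA' : ∀ X Y, τ ![X, A Y] = α ![X, Y] := fun X Y => by
    rw [two_swap, hA, two_swap, neg_neg]
  have h := congrFun hατ v
  simp only [wedge, Pi.zero_apply] at h
  simp only [Fin.sum_univ_four, wedge_self_apply, Function.update_apply]
  simp [hA, hA']
  linear_combination 4 * h

end TwoForms

section Trace

variable {V : Type*} [AddCommGroup V] [Module ℝ V]

theorem AlternatingMap.sum_update_basis_eq_trace {ι : Type*} [Fintype ι] [DecidableEq ι]
    (b : Module.Basis ι ℝ V) (μ : V [⋀^ι]→ₗ[ℝ] ℝ) (A : V →ₗ[ℝ] V) :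
    ∑ i, μ (Function.update b i (A (b i))) = LinearMap.trace ℝ V A * μ b := by
  rw [LinearMap.trace_eq_matrix_trace ℝ b, Matrix.trace, Finset.sum_mul]
  refine Finset.sum_congr rfl fun i _ => ?_
  rw [Matrix.diag_apply, LinearMap.toMatrix_apply]
  conv_lhs => rw [← b.sum_repr (A (b i))]
  rw [μ.map_update_sum, Finset.sum_eq_single i]
  · rw [μ.map_update_smul, Function.update_eq_self, smul_eq_mul]
  · intro j _ hj
    rw [μ.map_update_smul, μ.map_update_self _ hj.symm, smul_zero]
  · simp

end Trace

section TopForms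

variable {V : Type*} [AddCommGroup V] [Module ℝ V]

theorem AlternatingMap.smul_eq_sum_update_smul_basis {ι : Type*} [Fintype ι] [DecidableEq ι]
    (b : Module.Basis ι ℝ V) (μ : V [⋀^ι]→ₗ[ℝ] ℝ) (v : V) :
    μ b • v = ∑ i, μ (Function.update b i v) • b i := by
  conv_lhs => rw [← b.sum_repr v, Finset.smul_sum]
  refine Finset.sum_congr rfl fun i _ => ?_
  rw [smul_smul]
  congr 1
  conv_rhs => rw [← b.sum_repr v]
  rw [μ.map_update_sum, Finset.sum_eq_single i]
  · rw [μ.map_update_smul, Function.update_eq_self, smul_eq_mul, mul_comm]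
  · intro j _ hj
    rw [μ.map_update_smul, μ.map_update_self _ hj.symm, smul_zero]
  · simp

theorem AlternatingMap.smul_eq_sum_update_smul [FiniteDimensional ℝ V] {k : ℕ}
    (hk : Module.finrank ℝ V = k)
    (μ : V [⋀^Fin k]→ₗ[ℝ] ℝ) {e : Fin k → V} (he : μ e ≠ 0) (v : V) :
    μ e • v = ∑ i, μ (Function.update e i v) • e i := by
  have hli : LinearIndependent ℝ e := by
    by_contra h
    exact he (μ.map_linearDependent e h)
  rcases Nat.eq_zero_or_pos k with rfl | hpos
  · have : Subsingleton V := by rwa [← Module.finrank_zero_iff (R := ℝ)]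
    exact Subsingleton.elim _ _
  · have : Nonempty (Fin k) := ⟨⟨0, hpos⟩⟩
    have h := smul_eq_sum_update_smul_basis
      (basisOfLinearIndependentOfCardEqFinrank hli (by simp [hk])) μ v
    simpa using h

theorem AlternatingMap.sum_update_eq_zero {ι : Type*} [Fintype ι] [DecidableEq ι]
    (μ : V [⋀^ι]→ₗ[ℝ] ℝ) {v w : ι → V} {i j : ι} (hij : i ≠ j) (hv : v i = v j)
    (hw : w i = w j) : ∑ m, μ (Function.update v m (w m)) = 0 := by
  rw [Finset.sum_eq_add i j hij]
  · have : Function.update v j (w j) = Function.update v i (w i) ∘ Equiv.swap i j := by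
      ext m
      rcases eq_or_ne m i with rfl | hi
      · simp [hij, hij.symm, hv]
      rcases eq_or_ne m j with rfl | hj
      · simp [hw]
      · simp [Equiv.swap_apply_of_ne_of_ne hi hj, hi, hj]
    rw [this, μ.map_swap _ hij, add_neg_cancel]
  · intro m _ hm
    refine μ.map_eq_zero_of_eq _ (i := i) (j := j) ?_ hij
    rw [Function.update_of_ne hm.1.symm, Function.update_of_ne hm.2.symm, hv]
  · simp
  · simp

/-- A multilinear map that vanishes as soon as one argument lies in the kernel of `ev` depends
only on the images of its arguments under `ev`. -/
theorem MultilinearMap.eq_of_forall_eq {ι S : Type*} [Fintype ι] [DecidableEq ι] [AddCommGroup S]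
    [Module ℝ S] (T : MultilinearMap ℝ (fun _ : ι => S) ℝ) (ev : S →ₗ[ℝ] V)
    (hT : ∀ (Y : ι → S) (i : ι) (Z : S), ev Z = 0 → T (Function.update Y i Z) = 0)
    {Y Y' : ι → S} (h : ∀ i, ev (Y i) = ev (Y' i)) : T Y = T Y' := by
  suffices ∀ s : Finset ι, T (s.piecewise Y' Y) = T Y by
    simpa using (this Finset.univ).symm
  intro s
  induction s using Finset.induction_on with
  | empty => simp
  | insert a s ha ih =>
    rw [Finset.piecewise_insert, ← ih]
    have h1 : T (Function.update (s.piecewise Y' Y) a (Y' a - Y a)) = 0 :=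
      hT _ _ _ (by rw [map_sub, h, sub_self])
    rw [T.map_update_sub, sub_eq_zero] at h1
    rw [h1]
    congr 1
    rw [Function.update_eq_self_iff]
    simp [ha]

end TopForms

section LieDerivative

variable {E : Type*} [NormedAddCommGroup E] [NormedSpace ℝ E]
  {H : Type*} [TopologicalSpace H] {I : ModelWithCorners ℝ E H}
  {N : Type*} [TopologicalSpace N] [ChartedSpace H N] [IsManifold I ∞ N]
  {F : Type*} [NormedAddCommGroup F] [NormedSpace ℝ F]
  {A : N → Type*} [TopologicalSpace (TotalSpace F A)]
  [∀ x, AddCommGroup (A x)] [∀ x, Module ℝ (A x)] [∀ x, TopologicalSpace (A x)]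
  [FiberBundle F A] [VectorBundle ℝ F A]

theorem ContMDiffSection.update_apply {ι : Type*} [DecidableEq ι] (Y : ι → Cₛ^∞⟮I; F, A⟯) (i : ι)
    (Z : Cₛ^∞⟮I; F, A⟯) (x : N) :
    (fun j => Function.update Y i Z j x) = Function.update (fun j => Y j x) i (Z x) := by
  ext j
  rcases eq_or_ne j i with rfl | h <;> simp [*]

/-- Evaluation of smooth sections at a point. -/
def ContMDiffSection.evalAt (x : N) : Cₛ^∞⟮I; F, A⟯ →ₗ[ℝ] A x where
  toFun X := X x
  map_add' _ _ := rfl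
  map_smul' _ _ := rfl

theorem ContMDiffSection.smul_eq_funSMul (c : ℝ) (X : Cₛ^∞⟮I; F, A⟯) :
    c • X = X.funSMul (ContMDiffMap.const c) := by
  ext x; rfl

theorem ContMDiffSection.sum_apply {ι : Type*} (s : Finset ι) (X : ι → Cₛ^∞⟮I; F, A⟯) (x : N) :
    (∑ i ∈ s, X i) x = ∑ i ∈ s, X i x :=
  map_sum (ContMDiffSection.evalAt x) X s

namespace LieAlgebroid

variable (L : LieAlgebroid I F A) {k : ℕ} {α : ∀ x : N, A x [⋀^Fin k]→L[ℝ] ℝ}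

theorem lieDer_apply (X : Cₛ^∞⟮I; F, A⟯) (α : ∀ x : N, A x [⋀^Fin k]→L[ℝ] ℝ)
    (Y : Fin k → Cₛ^∞⟮I; F, A⟯) (x : N) :
    L.lieDer X α Y x = L.der X (fun y => α y (fun i => Y i y)) x
      - ∑ m, α x (Function.update (fun j => Y j x) m (L.bracket X (Y m) x)) := by
  simp only [lieDer, ContMDiffSection.update_apply]

theorem lieDer_update (X : Cₛ^∞⟮I; F, A⟯) (α : ∀ x : N, A x [⋀^Fin k]→L[ℝ] ℝ)
    (Y : Fin k → Cₛ^∞⟮I; F, A⟯) (i : Fin k) (Z : Cₛ^∞⟮I; F, A⟯) (x : N) :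
    L.lieDer X α (Function.update Y i Z) x
      = L.der X (fun y => α y (Function.update (fun j => Y j y) i (Z y))) x
        - (α x (Function.update (fun j => Y j x) i (L.bracket X Z x))
          + ∑ m ∈ Finset.univ.erase i, α x (Function.update
              (Function.update (fun j => Y j x) m (L.bracket X (Y m) x)) i (Z x))) := by
  rw [lieDer_apply, ← Finset.add_sum_erase _ _ (Finset.mem_univ i)]
  simp only [ContMDiffSection.update_apply, Function.update_self, Function.update_idem]
  congr 2
  refine Finset.sum_congr rfl fun m hm => ?_
  have hm := Finset.ne_of_mem_erase hm
  rw [Function.update_of_ne hm, Function.update_comm hm]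

theorem contMDiff_update (hα : α ∈ smoothForms I F A k) (Y : Fin k → Cₛ^∞⟮I; F, A⟯) (i : Fin k)
    (Z : Cₛ^∞⟮I; F, A⟯) :
    ContMDiff I 𝓘(ℝ, ℝ) ∞ fun y => α y (Function.update (fun j => Y j y) i (Z y)) := by
  have := hα (Function.update Y i Z)
  simpa only [ContMDiffSection.update_apply] using this

theorem lieDer_update_add (hα : α ∈ smoothForms I F A k) (X : Cₛ^∞⟮I; F, A⟯)
    (Y : Fin k → Cₛ^∞⟮I; F, A⟯) (i : Fin k) (Z Z' : Cₛ^∞⟮I; F, A⟯) (x : N) :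
    L.lieDer X α (Function.update Y i (Z + Z')) x
      = L.lieDer X α (Function.update Y i Z) x + L.lieDer X α (Function.update Y i Z') x := by
  simp only [lieDer_update, L.bracket_add, ContMDiffSection.coe_add, Pi.add_apply,
    ContinuousAlternatingMap.map_update_add, Finset.sum_add_distrib]
  rw [L.der_add X (contMDiff_update hα Y i Z) (contMDiff_update hα Y i Z')]
  ring

theorem lieDer_update_funSMul (hα : α ∈ smoothForms I F A k) (X : Cₛ^∞⟮I; F, A⟯)
    (Y : Fin k → Cₛ^∞⟮I; F, A⟯) (i : Fin k) (f : C^∞⟮I, N; 𝓘(ℝ, ℝ), ℝ⟯) (Z : Cₛ^∞⟮I; F, A⟯)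
    (x : N) :
    L.lieDer X α (Function.update Y i (Z.funSMul f)) x
      = f x * L.lieDer X α (Function.update Y i Z) x := by
  simp only [lieDer_update, L.bracket_funSMul, ContMDiffSection.coe_add, Pi.add_apply,
    ContMDiffSection.funSMul_apply, ContinuousAlternatingMap.map_update_add,
    ContinuousAlternatingMap.map_update_smul, smul_eq_mul, ← Finset.mul_sum]
  rw [L.der_mul X f.contMDiff (contMDiff_update hα Y i Z)]
  change _ - (_ + L.der X f x * _ + _) = _
  ring

/-- The Lie derivative of a smooth form at `x`, as an alternating map of sections. -/
def lieDerForm (hα : α ∈ smoothForms I F A k) (X : Cₛ^∞⟮I; F, A⟯) (x : N) :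
    Cₛ^∞⟮I; F, A⟯ [⋀^Fin k]→ₗ[ℝ] ℝ where
  toFun Y := L.lieDer X α Y x
  map_update_add' := by
    intro inst Y i Z Z'
    obtain rfl : inst = instDecidableEqFin k := Subsingleton.elim _ _
    exact L.lieDer_update_add hα X Y i Z Z' x
  map_update_smul' := by
    intro inst Y i c Z
    obtain rfl : inst = instDecidableEqFin k := Subsingleton.elim _ _
    rw [ContMDiffSection.smul_eq_funSMul]
    exact L.lieDer_update_funSMul hα X Y i _ Z x
  map_eq_zero_of_eq' := by
    intro Y i j hY hij
    change L.lieDer X α Y x = 0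
    have h1 : (fun y => α y (fun i => Y i y)) = fun _ => 0 := funext fun y =>
      (α y).map_eq_zero_of_eq _ (by simp only [hY]) hij
    rw [lieDer_apply, h1, der_const, zero_sub, neg_eq_zero]
    exact (α x).toAlternatingMap.sum_update_eq_zero (w := fun m => L.bracket X (Y m) x) hij
      (by simp only [hY]) (by simp only [hY])

theorem lieDer_smul_form (hα : α ∈ smoothForms I F A k) {f : N → ℝ}
    (hf : ContMDiff I 𝓘(ℝ, ℝ) ∞ f) (X : Cₛ^∞⟮I; F, A⟯) (Y : Fin k → Cₛ^∞⟮I; F, A⟯) (x : N) :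
    L.lieDer X (fun y => f y • α y) Y x
      = f x * L.lieDer X α Y x + L.der X f x * α x (fun i => Y i x) := by
  simp only [lieDer_apply, ContinuousAlternatingMap.smul_apply, smul_eq_mul, ← Finset.mul_sum]
  rw [L.der_mul X hf (hα Y)]
  ring

end LieAlgebroid

end LieDerivative

section Modular

variable {E : Type*} [NormedAddCommGroup E] [NormedSpace ℝ E] [FiniteDimensional ℝ E]
  {H : Type*} [TopologicalSpace H] {I : ModelWithCorners ℝ E H}
  {N : Type*} [TopologicalSpace N] [ChartedSpace H N] [IsManifold I ∞ N] [T2Space N]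

local notation "𝔛" => Cₛ^∞⟮I; E, (fun x : N => TangentSpace I x)⟯

theorem exists_frame_of_ne_zero {k : ℕ} (hk : Module.finrank ℝ E = k) (x : N)
    {α : TangentSpace I x [⋀^Fin k]→L[ℝ] ℝ} (hα : α ≠ 0) :
    ∃ e : Fin k → 𝔛, α (fun i => e i x) ≠ 0 := by
  let b : Module.Basis (Fin k) ℝ E := Module.finBasisOfFinrankEq ℝ E hk
  choose e he using fun i => exists_section_apply_eq (I := I) (F := E)
    (A := fun x : N => TangentSpace I x) x (b i)
  refine ⟨e, fun h => hα ?_⟩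
  simp only [he] at h
  apply ContinuousAlternatingMap.toAlternatingMap_injective
  by_contra h0
  exact (AlternatingMap.map_basis_ne_zero_iff (ι := Fin k) (M := E) b α.toAlternatingMap).2 h0 h

theorem smoothForms_smul_eq_sum {k : ℕ} (hk : Module.finrank ℝ E = k)
    {α : ∀ x : N, TangentSpace I x [⋀^Fin k]→L[ℝ] ℝ} (e : Fin k → 𝔛) (x : N)
    (he : α x (fun i => e i x) ≠ 0) (v : TangentSpace I x) :
    α x (fun i => e i x) • v
      = ∑ i, α x (Function.update (fun i => e i x) i v) • e i x := by
  have : FiniteDimensional ℝ (TangentSpace I x) := inferInstanceAs (FiniteDimensional ℝ E)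
  exact AlternatingMap.smul_eq_sum_update_smul hk (α x).toAlternatingMap he v

theorem tangentLieAlgebroid_lieDer_eq_smul {k : ℕ} (hk : Module.finrank ℝ E = k)
    {α : ∀ x : N, TangentSpace I x [⋀^Fin k]→L[ℝ] ℝ}
    (hα : α ∈ smoothForms I E (fun x : N => TangentSpace I x) k) (X : 𝔛) {x : N}
    (hx : α x ≠ 0) :
    ∃ c : ℝ, ∀ Y, (tangentLieAlgebroid I N).lieDer X α Y x = c * α x (fun i => Y i x) := by
  obtain ⟨e, he⟩ := exists_frame_of_ne_zero hk x hx
  set T := (tangentLieAlgebroid I N).lieDerForm hα X x with hT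
  let g : C^∞⟮I, N; 𝓘(ℝ, ℝ), ℝ⟯ := ⟨fun y => α y (fun i => e i y), hα e⟩
  have hker : ∀ (Y : Fin k → 𝔛) (i : Fin k) (Z : 𝔛), ContMDiffSection.evalAt x Z = 0 →
      T (Function.update Y i Z) = 0 := by
    intro Y i Z hZ
    let a : Fin k → C^∞⟮I, N; 𝓘(ℝ, ℝ), ℝ⟯ := fun j =>
      ⟨fun y => α y (Function.update (fun i => e i y) j (Z y)),
        LieAlgebroid.contMDiff_update hα e j Z⟩
    have hsum : Z.funSMul (g * g) = ∑ j, (e j).funSMul (g * a j) := by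
      ext y
      rw [ContMDiffSection.sum_apply]
      change (g y * g y) • Z y = ∑ j, (g y * a j y) • e j y
      by_cases hy : g y = 0
      · simp [hy]
      · simp only [mul_smul, ← Finset.smul_sum]
        exact congrArg (g y • ·) (smoothForms_smul_eq_sum hk e y hy (Z y))
    have h1 : T (Function.update Y i (Z.funSMul (g * g)))
        = (g x * g x) * T (Function.update Y i Z) :=
      (tangentLieAlgebroid I N).lieDer_update_funSMul hα X Y i (g * g) Z x
    have h2 : T (Function.update Y i (Z.funSMul (g * g))) = 0 := by
      rw [hsum, T.map_update_sum]
      refine Finset.sum_eq_zero fun j _ => ?_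
      refine ((tangentLieAlgebroid I N).lieDer_update_funSMul hα X Y i (g * a j) (e j) x).trans ?_
      have : a j x = 0 := by
        change α x (Function.update _ j (Z x)) = 0
        have hZ : Z x = 0 := hZ
        rw [hZ]
        exact (α x).map_coord_zero j (Function.update_self ..)
      change g x * a j x * _ = 0
      rw [this]; simp
    rw [h1] at h2
    exact (mul_eq_zero.1 h2).resolve_left (mul_self_ne_zero.2 he)
  let b : Module.Basis (Fin k) ℝ E := Module.finBasisOfFinrankEq ℝ E hk
  choose s hs using fun i => exists_section_apply_eq (I := I) (F := E)
    (A := fun x : N => TangentSpace I x) x (b i)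
  let ext : E →ₗ[ℝ] 𝔛 := b.constr ℝ s
  have hext : ∀ v : E, ext v x = v := by
    intro v
    have : (ContMDiffSection.evalAt x : 𝔛 →ₗ[ℝ] E) ∘ₗ ext = LinearMap.id := by
      refine b.ext fun i => ?_
      rw [LinearMap.comp_apply, b.constr_basis]
      exact hs i
    exact LinearMap.congr_fun this v
  let T' : E [⋀^Fin k]→ₗ[ℝ] ℝ := T.compLinearMap ext
  let α' : E [⋀^Fin k]→ₗ[ℝ] ℝ := (α x).toAlternatingMap
  have hα' : α' ≠ 0 := fun h => hx (ContinuousAlternatingMap.toAlternatingMap_injective h)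
  have hb := (AlternatingMap.map_basis_ne_zero_iff b α').2 hα'
  have hc : T' = (T' b / α' b) • α' := by
    rw [T'.eq_smul_basis_det b, α'.eq_smul_basis_det b]
    ext v
    simp only [AlternatingMap.smul_apply, smul_eq_mul, b.det_self, mul_one]
    field_simp
  refine ⟨T' b / α' b, fun Y => ?_⟩
  have h1 : T Y = T' (fun i => Y i x) :=
    T.toMultilinearMap.eq_of_forall_eq (ContMDiffSection.evalAt x) hker
      (fun i => (hext (Y i x)).symm)
  refine h1.trans ?_
  rw [hc]
  simp only [AlternatingMap.smul_apply, smul_eq_mul, div_mul_cancel₀ _ hb]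
  rfl

theorem LieAlgebroid.IsDeformation.anchorSection_eq
    {L : LieAlgebroid I E (fun x : N => TangentSpace I x)}
    {J : EndField I E (fun x : N => TangentSpace I x)}
    (hL : (tangentLieAlgebroid I N).IsDeformation L J) (X : 𝔛) : L.anchorSection X = J.app X := by
  ext x
  exact LinearMap.congr_fun (hL.anchor_eq x) (X x)

theorem LieAlgebroid.IsDeformation.der_eq {L : LieAlgebroid I E (fun x : N => TangentSpace I x)}
    {J : EndField I E (fun x : N => TangentSpace I x)}
    (hL : (tangentLieAlgebroid I N).IsDeformation L J) (X : 𝔛) (f : N → ℝ) (x : N) :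
    L.der X f x = (tangentLieAlgebroid I N).der (J.app X) f x := by
  rw [LieAlgebroid.der, hL.anchor_eq]; rfl

/-- If `J` acts trivially on the volume form `μ` as a derivation, the Lie derivatives of `μ` with
respect to the deformed algebroid and to the image vector field agree. -/
theorem LieAlgebroid.IsDeformation.lieDer_eq {k : ℕ} (hk : Module.finrank ℝ E = k)
    {L : LieAlgebroid I E (fun x : N => TangentSpace I x)}
    {J : EndField I E (fun x : N => TangentSpace I x)}
    (hL : (tangentLieAlgebroid I N).IsDeformation L J)
    {μ : ∀ x : N, TangentSpace I x [⋀^Fin k]→L[ℝ] ℝ}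
    (hμ : μ ∈ smoothForms I E (fun x : N => TangentSpace I x) k) (hμ0 : ∀ x, μ x ≠ 0)
    (hJ : ∀ x (v : Fin k → TangentSpace I x),
      ∑ i, μ x (Function.update v i (J.toFun x (v i))) = 0)
    (X : 𝔛) (Y : Fin k → 𝔛) (x : N) :
    L.lieDer X μ Y x = (tangentLieAlgebroid I N).lieDer (J.app X) μ Y x := by
  obtain ⟨c, hc⟩ := tangentLieAlgebroid_lieDer_eq_smul hk hμ X (hμ0 x)
  set T := tangentLieAlgebroid I N
  let a : Fin k → Fin k → ℝ := fun i m => μ x (Function.update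
    (fun j => Function.update Y i (J.app (Y i)) j x) m
    (T.bracket X (Function.update Y i (J.app (Y i)) m) x))
  let b : Fin k → Fin k → ℝ := fun m i => μ x (Function.update
    (Function.update (fun j => Y j x) m (T.bracket X (Y m) x)) i
    (J.toFun x (Function.update (fun j => Y j x) m (T.bracket X (Y m) x) i)))
  have ha : ∑ i, ∑ m, a i m = 0 := by
    have h1 : ∑ i, T.lieDer X μ (Function.update Y i (J.app (Y i))) x = 0 := by
      simp only [hc, ← Finset.mul_sum, ContMDiffSection.update_apply]
      exact mul_eq_zero_of_right _ (hJ x fun i => Y i x)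
    simp only [T.lieDer_apply X μ, Finset.sum_sub_distrib] at h1
    rw [← T.der_sum Finset.univ X (fun i => hμ _)] at h1
    have h2 : (fun y => ∑ i, μ y (fun j => Function.update Y i (J.app (Y i)) j y))
        = fun _ => 0 := by
      ext y
      simp only [ContMDiffSection.update_apply]
      exact hJ y fun i => Y i y
    rw [h2, T.der_const, zero_sub, neg_eq_zero] at h1
    exact h1
  have hb : ∑ m, ∑ i, b m i = 0 := Finset.sum_eq_zero fun m _ => hJ x _
  have hab : ∀ i m, m ≠ i → a i m = b m i := by
    intro i m h
    simp only [a, b, ContMDiffSection.update_apply]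
    rw [Function.update_of_ne h, Function.update_of_ne h.symm, Function.update_comm h]
    rfl
  have hdiag : ∑ i, a i i = ∑ i, b i i := by
    rw [Finset.sum_comm] at hb
    have h1 : ∑ i, ∑ m, (a i m - b m i) = 0 := by
      simp only [Finset.sum_sub_distrib]; rw [ha, hb, sub_zero]
    have h2 : ∀ i, ∑ m, (a i m - b m i) = a i i - b i i := fun i =>
      Finset.sum_eq_single i (fun m _ hm => by rw [hab i m hm, sub_self]) (by simp)
    simp only [h2, Finset.sum_sub_distrib] at h1
    linarith
  rw [L.lieDer_apply, T.lieDer_apply, hL.der_eq]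
  congr 1
  have hbr : ∀ m, L.bracket X (Y m) x = T.bracket (J.app X) (Y m) x
      + T.bracket X (J.app (Y m)) x - J.toFun x (T.bracket X (Y m) x) := fun m => by
    rw [hL.bracket_eq]; rfl
  simp only [hbr, ContinuousAlternatingMap.map_update_add, ContinuousAlternatingMap.map_update_sub,
    Finset.sum_add_distrib, Finset.sum_sub_distrib]
  have ea : ∀ i, a i i = μ x (Function.update (fun j => Y j x) i (T.bracket X (J.app (Y i)) x)) :=
    fun i => by simp only [a, ContMDiffSection.update_apply, Function.update_self,
      Function.update_idem]
  have eb : ∀ i, b i i = μ x (Function.update (fun j => Y j x) i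
      (J.toFun x (T.bracket X (Y i) x))) :=
    fun i => by simp only [b, Function.update_self, Function.update_idem]
  simp only [ea, eb] at hdiag
  linarith

theorem exists_smooth_ratio {k : ℕ} (hk : Module.finrank ℝ E = k)
    {μ l : ∀ x : N, TangentSpace I x [⋀^Fin k]→L[ℝ] ℝ}
    (hμ : μ ∈ smoothForms I E (fun x : N => TangentSpace I x) k) (hμ0 : ∀ x, μ x ≠ 0)
    (hl : l ∈ smoothForms I E (fun x : N => TangentSpace I x) k) :
    ∃ f : N → ℝ, ContMDiff I 𝓘(ℝ, ℝ) ∞ f ∧ l = fun x => f x • μ x := by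
  let b : Module.Basis (Fin k) ℝ E := Module.finBasisOfFinrankEq ℝ E hk
  have hb : ∀ x, (μ x).toAlternatingMap b ≠ 0 := fun x =>
    (AlternatingMap.map_basis_ne_zero_iff (M := E) b (μ x).toAlternatingMap).2
      fun h => hμ0 x (ContinuousAlternatingMap.toAlternatingMap_injective h)
  have hf : ∀ x (v : Fin k → TangentSpace I x),
      l x v = ((l x).toAlternatingMap b / (μ x).toAlternatingMap b) * μ x v := by
    intro x v
    have h1 := AlternatingMap.congr_fun (AlternatingMap.eq_smul_basis_det (M := E) b
      (μ x).toAlternatingMap) v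
    have h2 := AlternatingMap.congr_fun (AlternatingMap.eq_smul_basis_det (M := E) b
      (l x).toAlternatingMap) v
    have h1' : μ x v = (μ x).toAlternatingMap b * b.det v := h1
    have h2' : l x v = (l x).toAlternatingMap b * b.det v := h2
    rw [h1', h2']
    have := hb x
    field_simp
  refine ⟨_, fun x => ?_, funext fun x => ContinuousAlternatingMap.ext (hf x)⟩
  obtain ⟨e, he⟩ := exists_frame_of_ne_zero hk x (hμ0 x)
  have h1 : ContMDiffAt I 𝓘(ℝ, ℝ) ∞
      (fun y => l y (fun i => e i y) / μ y (fun i => e i y)) x :=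
    ContMDiffAt.div₀ (hl e x) (hμ e x) he
  refine h1.congr_of_eventuallyEq ?_
  filter_upwards [(hμ e).continuous.continuousAt.eventually_ne he] with y hy
  rw [hf y (fun i => e i y), mul_div_assoc, div_self hy, mul_one]

theorem LieAlgebroid.der_log {F : Type*} [NormedAddCommGroup F] [NormedSpace ℝ F]
    {A : N → Type*} [TopologicalSpace (TotalSpace F A)]
    [∀ x, AddCommGroup (A x)] [∀ x, Module ℝ (A x)] [∀ x, TopologicalSpace (A x)]
    [FiberBundle F A] [VectorBundle ℝ F A] (L : LieAlgebroid I F A) (X : Cₛ^∞⟮I; F, A⟯)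
    {q : N → ℝ} (hq : ContMDiff I 𝓘(ℝ, ℝ) ∞ q) {x : N} (hx : q x ≠ 0) :
    L.der X (fun y => Real.log (q y)) x = (q x)⁻¹ * L.der X q x := by
  have h1 := (Real.hasDerivAt_log hx).hasFDerivAt.hasMFDerivAt.comp x
    ((hq x).mdifferentiableAt (by simp)).hasMFDerivAt
  have h2 := congrArg (fun T : E →L[ℝ] ℝ => T (L.anchor x (X x))) h1.mfderiv
  refine h2.trans ?_
  refine (mul_comm _ _).trans ?_
  rfl

theorem LieAlgebroid.IsDeformation.isModularForm_zero
    {L : LieAlgebroid I E (fun x : N => TangentSpace I x)}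
    {J : EndField I E (fun x : N => TangentSpace I x)}
    (hL : (tangentLieAlgebroid I N).IsDeformation L J)
    {μ : ∀ x : N, TangentSpace I x [⋀^Fin (Module.finrank ℝ E)]→L[ℝ] ℝ}
    (hμ : IsVolumeForm I E (fun x : N => TangentSpace I x) μ)
    (hJ : ∀ x (v : Fin (Module.finrank ℝ E) → TangentSpace I x),
      ∑ i, μ x (Function.update v i (J.toFun x (v i))) = 0) :
    L.IsModularForm μ μ 0 := by
  intro X Y Z x
  obtain ⟨c, hc⟩ := tangentLieAlgebroid_lieDer_eq_smul rfl hμ.1 (J.app X) (hμ.2 x)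
  rw [hL.lieDer_eq rfl hμ.1 hμ.2 hJ, hL.anchorSection_eq, hc, hc]
  change 0 * _ = _
  ring

theorem LieAlgebroid.IsDeformation.mem_coboundaries_of_isModularForm
    {L : LieAlgebroid I E (fun x : N => TangentSpace I x)}
    {J : EndField I E (fun x : N => TangentSpace I x)}
    (hL : (tangentLieAlgebroid I N).IsDeformation L J)
    {μ : ∀ x : N, TangentSpace I x [⋀^Fin (Module.finrank ℝ E)]→L[ℝ] ℝ}
    (hμ : IsVolumeForm I E (fun x : N => TangentSpace I x) μ)
    (hJ : ∀ x (v : Fin (Module.finrank ℝ E) → TangentSpace I x),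
      ∑ i, μ x (Function.update v i (J.toFun x (v i))) = 0)
    {l v : ∀ x : N, TangentSpace I x [⋀^Fin (Module.finrank ℝ E)]→L[ℝ] ℝ}
    (hl : IsVolumeForm I E (fun x : N => TangentSpace I x) l)
    (hv : IsVolumeForm I E (fun x : N => TangentSpace I x) v)
    {ξ : ∀ x : N, TangentSpace I x →ₗ[ℝ] ℝ} (hξ : L.IsModularForm l v ξ) :
    ξ ∈ L.coboundaries := by
  obtain ⟨f, hf, rfl⟩ := exists_smooth_ratio rfl hμ.1 hμ.2 hl.1
  obtain ⟨g, hg, rfl⟩ := exists_smooth_ratio rfl hμ.1 hμ.2 hv.1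
  have hf0 : ∀ x, f x ≠ 0 := fun x h => hl.2 x (by simp only [h, zero_smul])
  have hg0 : ∀ x, g x ≠ 0 := fun x h => hv.2 x (by simp only [h, zero_smul])
  have hlog : ∀ {q : N → ℝ}, ContMDiff I 𝓘(ℝ, ℝ) ∞ q → (∀ x, q x ≠ 0) →
      ContMDiff I 𝓘(ℝ, ℝ) ∞ fun x => Real.log (q x) := fun {q} hq hq0 x =>
    (Real.contDiffAt_log.2 (hq0 x)).contMDiffAt.comp x (hq x)
  refine ⟨⟨fun x => Real.log (g x) - Real.log (f x), (hlog hg hg0).sub (hlog hf hf0)⟩,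
    fun x w => ?_⟩
  obtain ⟨e, he⟩ := exists_frame_of_ne_zero rfl x (hμ.2 x)
  obtain ⟨X, rfl⟩ := exists_section_apply_eq (I := I) (F := E)
    (A := fun x : N => TangentSpace I x) x w
  have h := hξ X e e x
  obtain ⟨c, hc⟩ := tangentLieAlgebroid_lieDer_eq_smul rfl hμ.1 (J.app X) (hμ.2 x)
  rw [LieAlgebroid.lieDer_smul_form _ hμ.1 hg, L.lieDer_smul_form hμ.1 hf,
    hL.lieDer_eq rfl hμ.1 hμ.2 hJ, hL.anchorSection_eq, hc, hL.der_eq] at h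
  simp only [ContinuousAlternatingMap.smul_apply, smul_eq_mul] at h
  change ξ x (X x) = L.der X (fun x => Real.log (g x) - Real.log (f x)) x
  rw [L.der_sub X (hlog hg hg0) (hlog hf hf0), L.der_log X hg (hg0 x), L.der_log X hf (hf0 x),
    hL.der_eq, hL.der_eq]
  have hf0 := hf0 x
  have hg0 := hg0 x
  set m := μ x (fun i => e i x)
  field_simp
  refine mul_right_cancel₀ (mul_ne_zero he he) ?_
  linear_combination h

end Modular

section ExactForms

variable {E : Type*} [NormedAddCommGroup E] [NormedSpace ℝ E] [FiniteDimensional ℝ E]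
  {H : Type*} [TopologicalSpace H] {I : ModelWithCorners ℝ E H} [I.Boundaryless]
  {N : Type*} [TopologicalSpace N] [ChartedSpace H N] [IsManifold I ∞ N] [T2Space N]

local notation "𝔛" => Cₛ^∞⟮I; E, (fun x : N => TangentSpace I x)⟯

theorem mem_smoothForms_one_iff {θ : ∀ x : N, TangentSpace I x [⋀^Fin 1]→L[ℝ] ℝ} :
    θ ∈ smoothForms I E (fun x : N => TangentSpace I x) 1 ↔
      ∀ X : 𝔛, ContMDiff I 𝓘(ℝ, ℝ) ∞ fun x => θ x ![X x] := by
  have e : ∀ (X : Fin 1 → 𝔛) (x : N), (fun i => X i x) = ![X 0 x] := fun X x => by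
    ext i; fin_cases i; rfl
  refine ⟨fun h X => ?_, fun h X => ?_⟩
  · have := h fun _ => X
    simpa only [e] using this
  · simpa only [e] using h (X 0)

theorem mem_smoothForms_two_iff {τ : ∀ x : N, TangentSpace I x [⋀^Fin 2]→L[ℝ] ℝ} :
    τ ∈ smoothForms I E (fun x : N => TangentSpace I x) 2 ↔
      ∀ X Y : 𝔛, ContMDiff I 𝓘(ℝ, ℝ) ∞ fun x => τ x ![X x, Y x] := by
  have e : ∀ (X : Fin 2 → 𝔛) (x : N), (fun i => X i x) = ![X 0 x, X 1 x] := fun X x => by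
    ext i; fin_cases i <;> rfl
  refine ⟨fun h X Y => ?_, fun h X => ?_⟩
  · have := h ![X, Y]
    simp only [e] at this
    exact this
  · simpa only [e] using h (X 0) (X 1)

theorem mextDeriv_mem_smoothForms {θ : ∀ x : N, TangentSpace I x [⋀^Fin 1]→L[ℝ] ℝ}
    (hθ : θ ∈ smoothForms I E (fun x : N => TangentSpace I x) 1) :
    mextDeriv I θ ∈ smoothForms I E (fun x : N => TangentSpace I x) 2 := by
  rw [mem_smoothForms_two_iff]
  intro X Y
  simp only [mextDeriv_one_apply hθ]
  have h := mem_smoothForms_one_iff.1 hθ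
  exact ((LieAlgebroid.contMDiff_der _ X (h Y)).sub (LieAlgebroid.contMDiff_der _ Y (h X))).sub
    (h _)

/-- The value of the exterior derivative of a smooth `2`-form on vector fields. -/
def cyclicDer (τ : ∀ x : N, TangentSpace I x [⋀^Fin 2]→L[ℝ] ℝ) (X Y Z : 𝔛) (x : N) : ℝ :=
  (tangentLieAlgebroid I N).der X (fun y => τ y ![Y y, Z y]) x
    - (tangentLieAlgebroid I N).der Y (fun y => τ y ![X y, Z y]) x
    + (tangentLieAlgebroid I N).der Z (fun y => τ y ![X y, Y y]) x
    - τ x ![(tangentLieAlgebroid I N).bracket X Y x, Z x]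
    + τ x ![(tangentLieAlgebroid I N).bracket X Z x, Y x]
    - τ x ![(tangentLieAlgebroid I N).bracket Y Z x, X x]

theorem cyclicDer_mextDeriv [Nontrivial E] {θ : ∀ x : N, TangentSpace I x [⋀^Fin 1]→L[ℝ] ℝ}
    (hθ : θ ∈ smoothForms I E (fun x : N => TangentSpace I x) 1) (X Y Z : 𝔛) (x : N) :
    cyclicDer (mextDeriv I θ) X Y Z x = 0 := by
  have h := mem_smoothForms_one_iff.1 hθ
  set T := tangentLieAlgebroid I N with hT
  have hd : ∀ X Y : 𝔛, ContMDiff I 𝓘(ℝ, ℝ) ∞ (T.der X fun y => θ y ![Y y]) := fun X Y =>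
    T.contMDiff_der X (h Y)
  have hdd : ∀ X Y Z : 𝔛, T.der X (fun y => mextDeriv I θ y ![Y y, Z y]) x
      = T.der X (T.der Y fun y => θ y ![Z y]) x - T.der X (T.der Z fun y => θ y ![Y y]) x
        - T.der X (fun y => θ y ![T.bracket Y Z y]) x := by
    intro X Y Z
    have e : (fun y => mextDeriv I θ y ![Y y, Z y])
        = fun y => ((T.der Y fun y => θ y ![Z y]) y - (T.der Z fun y => θ y ![Y y]) y)
          - θ y ![T.bracket Y Z y] := funext fun y => mextDeriv_one_apply hθ Y Z y
    rw [e, T.der_sub X ((hd Y Z).sub (hd Z Y)) (h _), T.der_sub X (hd Y Z) (hd Z Y)]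
  have hj : θ x ![T.bracket (T.bracket X Y) Z x] - θ x ![T.bracket (T.bracket X Z) Y x]
      + θ x ![T.bracket (T.bracket Y Z) X x] = 0 := by
    have e1 : T.bracket (T.bracket X Y) Z = T.bracket (T.bracket X Z) Y
        - T.bracket (T.bracket Y Z) X := by
      rw [T.bracket_skew (T.bracket Y Z) X, T.jacobi X Y Z, T.bracket_skew (T.bracket X Z) Y]
      abel
    have l : ∀ u v : TangentSpace I x, θ x ![u - v] = θ x ![u] - θ x ![v] := fun u v => by
      have h1 := (θ x).map_update_sub ![u] 0 u v
      have u0 : ∀ w, Function.update ![u] 0 w = ![w] := fun w => by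
        ext i; fin_cases i; simp
      simpa only [u0] using h1
    rw [e1, ContMDiffSection.coe_sub, Pi.sub_apply, l]
    ring
  rw [cyclicDer, hdd, hdd, hdd, mextDeriv_one_apply hθ, mextDeriv_one_apply hθ,
    mextDeriv_one_apply hθ, tangentLieAlgebroid_der_bracket X Y (h Z),
    tangentLieAlgebroid_der_bracket X Z (h Y), tangentLieAlgebroid_der_bracket Y Z (h X)]
  linear_combination hj

end ExactForms

section Canonical

variable {E : Type*} [NormedAddCommGroup E] [NormedSpace ℝ E] [FiniteDimensional ℝ E]
  {H : Type*} [TopologicalSpace H] {I : ModelWithCorners ℝ E H} [I.Boundaryless]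
  {M : Type*} [TopologicalSpace M] [ChartedSpace H M] [IsManifold I ∞ M] [T2Space M]

theorem Bundle.TotalSpace.t2Space {B F : Type*} [TopologicalSpace B] [TopologicalSpace F]
    [T2Space B] [T2Space F] (V : B → Type*) [TopologicalSpace (TotalSpace F V)]
    [∀ x, TopologicalSpace (V x)] [FiberBundle F V] : T2Space (TotalSpace F V) := by
  refine ⟨fun z z' hz => ?_⟩
  by_cases hb : z.proj = z'.proj
  · set e := trivializationAt F V z.proj with he
    have hs : z ∈ e.source := FiberBundle.mem_trivializationAt_proj_source
    have hs' : z' ∈ e.source := by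
      rw [e.mem_source, ← hb]; exact mem_baseSet_trivializationAt F V z.proj
    have hne : e z ≠ e z' := fun h => hz (e.injOn hs hs' h)
    obtain ⟨u, v, hu, hv, hzu, hzv, huv⟩ := t2_separation hne
    refine ⟨e.source ∩ e ⁻¹' u, e.source ∩ e ⁻¹' v,
      e.continuousOn.isOpen_inter_preimage e.open_source hu,
      e.continuousOn.isOpen_inter_preimage e.open_source hv, ⟨hs, hzu⟩, ⟨hs', hzv⟩, ?_⟩
    exact (huv.preimage e).mono inter_subset_right inter_subset_right
  · obtain ⟨u, v, hu, hv, hzu, hzv, huv⟩ := t2_separation hb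
    have hc := FiberBundle.continuous_proj F V
    exact ⟨_, _, hu.preimage hc, hv.preimage hc, hzu, hzv, huv.preimage _⟩

instance : T2Space (CotangentBundle I M) := Bundle.TotalSpace.t2Space _

/-- The canonical `1`-form of the cotangent bundle as a field of alternating forms. -/
def canonicalAlternatingForm (I : ModelWithCorners ℝ E H) (M : Type*) [TopologicalSpace M]
    [ChartedSpace H M] [IsManifold I ∞ M] (z : CotangentBundle I M) :
    TCotangent I M z [⋀^Fin 1]→L[ℝ] ℝ :=
  ContinuousAlternatingMap.ofSubsingleton ℝ _ _ (0 : Fin 1) (canonicalOneForm I M z)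

theorem canonicalTwoForm_eq (z : CotangentBundle I M) : canonicalTwoForm I M z
    = -mextDeriv (cotangentModel I) (canonicalAlternatingForm I M) z := rfl

theorem canonicalAlternatingForm_mem_smoothForms :
    canonicalAlternatingForm I M ∈ smoothForms (cotangentModel I) (E × (E →L[ℝ] ℝ))
      (TCotangent I M) 1 := by
  rw [mem_smoothForms_one_iff (I := cotangentModel I) (N := CotangentBundle I M)]
  intro X
  have hπ : ContMDiff (cotangentModel I) I ∞ (TotalSpace.proj : CotangentBundle I M → M) :=
    contMDiff_proj _
  have h1 : ContMDiff (cotangentModel I).tangent I.tangent ∞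
      (tangentMap (cotangentModel I) I (TotalSpace.proj : CotangentBundle I M → M)) :=
    hπ.contMDiff_tangentMap (by simp)
  have h2 := h1.comp X.contMDiff
  have h3 : ContMDiff (cotangentModel I) (I.prod 𝓘(ℝ, E →L[ℝ] ℝ)) ∞
      (fun z : CotangentBundle I M => z) := contMDiff_id
  have h4 := ContMDiff.clm_bundle_apply (F₁ := E) (F₂ := ℝ) (E₁ := fun x : M => TangentSpace I x)
    (E₂ := fun x : M => Bundle.Trivial M ℝ x) (b := fun z : CotangentBundle I M => z.proj)
    (ϕ := fun z => z.2)
    (v := fun z => mfderiv (cotangentModel I) I (TotalSpace.proj : CotangentBundle I M → M) z (X z))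
    h3 h2
  intro z
  have h5 := (contMDiffAt_totalSpace.1 (h4 z)).2
  exact h5

theorem extChartAt_cotangent_symm_apply (z : CotangentBundle I M) (y : E × (E →L[ℝ] ℝ)) :
    (extChartAt (cotangentModel I) z).symm y = ⟨(extChartAt I z.proj).symm y.1,
      y.2.comp ((trivializationAt E (TangentSpace I) z.proj).continuousLinearMapAt ℝ
        ((extChartAt I z.proj).symm y.1))⟩ := by
  rw [FiberBundle.extChartAt]
  change (⟨(extChartAt I z.proj).symm y.1,
    ((trivializationAt ℝ (Bundle.Trivial M ℝ) z.proj).symmL ℝ ((extChartAt I z.proj).symm y.1)).comp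
      (y.2.comp ((trivializationAt E (TangentSpace I) z.proj).continuousLinearMapAt ℝ
        ((extChartAt I z.proj).symm y.1)))⟩ : CotangentBundle I M) = _
  congr 1
  have h : (trivializationAt ℝ (Bundle.Trivial M ℝ) z.proj).symmL ℝ
      ((extChartAt I z.proj).symm y.1) = ContinuousLinearMap.id ℝ ℝ :=
    Bundle.Trivial.symmL_trivialization ℝ M ℝ _
  rw [h]
  rfl

theorem proj_extChartAt_cotangent_symm (z : CotangentBundle I M) (y : E × (E →L[ℝ] ℝ)) :
    ((extChartAt (cotangentModel I) z).symm y).proj = (extChartAt I z.proj).symm y.1 := by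
  rw [extChartAt_cotangent_symm_apply]

theorem formInChart_canonicalAlternatingForm (z : CotangentBundle I M) {y : E × (E →L[ℝ] ℝ)}
    (hy : y ∈ (extChartAt (cotangentModel I) z).target) (v : E × (E →L[ℝ] ℝ)) :
    formInChart (cotangentModel I) (canonicalAlternatingForm I M) z y ![v] = y.2 v.1 := by
  have hy1 : y.1 ∈ (extChartAt I z.proj).target := by
    rw [FiberBundle.extChartAt_target] at hy
    exact hy.1.1
  set φ := extChartAt (cotangentModel I) z
  set ψ := extChartAt I z.proj
  have hsrc : ψ.symm y.1 ∈ (chartAt H z.proj).source := by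
    simpa [ψ] using ψ.map_target hy1
  have h1 : formInChart (cotangentModel I) (canonicalAlternatingForm I M) z y ![v]
      = canonicalOneForm I M (φ.symm y)
        (mfderivWithin 𝓘(ℝ, E × (E →L[ℝ] ℝ)) (cotangentModel I) φ.symm
          (range (cotangentModel I)) y v) := rfl
  have hr : range (cotangentModel I) = univ := ModelWithCorners.range_eq_univ _
  have hr' : range I = univ := ModelWithCorners.range_eq_univ _
  have hφ : MDifferentiableAt 𝓘(ℝ, E × (E →L[ℝ] ℝ)) (cotangentModel I) φ.symm y := by
    have := mdifferentiableWithinAt_extChartAt_symm (I := cotangentModel I) hy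
    rwa [hr, mdifferentiableWithinAt_univ] at this
  have hψ : MDifferentiableAt 𝓘(ℝ, E) I ψ.symm y.1 := by
    have := mdifferentiableWithinAt_extChartAt_symm (I := I) hy1
    rwa [hr', mdifferentiableWithinAt_univ] at this
  have hπ : MDifferentiableAt (cotangentModel I) I (TotalSpace.proj : CotangentBundle I M → M)
      (φ.symm y) :=
    (contMDiff_proj (n := 1) (IB := I) (fun x : M => TangentSpace I x →L[ℝ] Bundle.Trivial M ℝ x)
      (φ.symm y)).mdifferentiableAt (by simp)
  have hc : (TotalSpace.proj : CotangentBundle I M → M) ∘ φ.symm = ψ.symm ∘ Prod.fst :=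
    funext fun y => proj_extChartAt_cotangent_symm z y
  have h2 : mfderiv (cotangentModel I) I (TotalSpace.proj : CotangentBundle I M → M) (φ.symm y)
        (mfderivWithin 𝓘(ℝ, E × (E →L[ℝ] ℝ)) (cotangentModel I) φ.symm
          (range (cotangentModel I)) y v)
      = mfderivWithin 𝓘(ℝ, E) I ψ.symm (range I) y.1 v.1 := by
    rw [hr, hr', mfderivWithin_univ, mfderivWithin_univ]
    have e1 := mfderiv_comp y hπ hφ
    have e2 := mfderiv_comp (I := 𝓘(ℝ, E × (E →L[ℝ] ℝ))) (I' := 𝓘(ℝ, E)) (I'' := I) y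
      (g := ψ.symm) (f := Prod.fst) hψ differentiableAt_fst.mdifferentiableAt
    have e3 : mfderiv 𝓘(ℝ, E × (E →L[ℝ] ℝ)) 𝓘(ℝ, E) (Prod.fst : E × (E →L[ℝ] ℝ) → E) y v
        = v.1 := by
      rw [mfderiv_eq_fderiv, fderiv_fst]; rfl
    have e4 := congrArg (fun f : E × (E →L[ℝ] ℝ) → M =>
      (show (E × (E →L[ℝ] ℝ)) →L[ℝ] E from mfderiv 𝓘(ℝ, E × (E →L[ℝ] ℝ)) I f y) v) hc
    exact ((congrArg (fun T => T v) e1).symm.trans e4).trans ((congrArg (fun T => T v) e2).trans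
      (congrArg (mfderiv 𝓘(ℝ, E) I ψ.symm y.1) e3))
  have h3 : mfderivWithin 𝓘(ℝ, E) I ψ.symm (range I) y.1 v.1
      = (trivializationAt E (TangentSpace I) z.proj).symmL ℝ (ψ.symm y.1) v.1 := by
    have h := TangentBundle.symmL_trivializationAt (I := I) hsrc
    rw [h]
    have : extChartAt I z.proj (ψ.symm y.1) = y.1 := ψ.right_inv hy1
    rw [this]
    rfl
  have h4 : φ.symm y = ⟨ψ.symm y.1, y.2.comp
      ((trivializationAt E (TangentSpace I) z.proj).continuousLinearMapAt ℝ (ψ.symm y.1))⟩ :=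
    extChartAt_cotangent_symm_apply z y
  have h5 := h2.trans h3
  rw [h1]
  have h6 : ∀ (z' : CotangentBundle I M) (b : M) (p : TangentSpace I b →L[ℝ] ℝ)
      (u : TCotangent I M z') (u' : TangentSpace I b), z' = ⟨b, p⟩ →
      mfderiv (cotangentModel I) I (TotalSpace.proj : CotangentBundle I M → M) z' u = u' →
      canonicalOneForm I M z' u = p u' := by
    rintro _ b p u _ rfl rfl; rfl
  rw [h6 _ _ _ _ _ h4 h5]
  have h7 := (trivializationAt E (TangentSpace I) z.proj).continuousLinearMapAt_symmL (R := ℝ)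
    (b := ψ.symm y.1) hsrc v.1
  exact congrArg y.2 h7

theorem mextDeriv_canonicalAlternatingForm_apply (z : CotangentBundle I M)
    (a b : E × (E →L[ℝ] ℝ)) :
    mextDeriv (cotangentModel I) (canonicalAlternatingForm I M) z ![a, b]
      = a.2 b.1 - b.2 a.1 := by
  set x₀ := extChartAt (cotangentModel I) z z
  set V : Fin 2 → E × (E →L[ℝ] ℝ) := ![a, b] with hV
  have h1 : mextDeriv (cotangentModel I) (canonicalAlternatingForm I M) z ![a, b]
      = extDeriv (formInChart (cotangentModel I) (canonicalAlternatingForm I M) z) x₀ V := by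
    rw [mextDeriv, mfderiv_extChartAt_self, ModelWithCorners.range_eq_univ, extDerivWithin_univ]
    simp only [← ModelWithCorners.range_eq_univ (cotangentModel I)]
    rfl
  have h2 : ∀ v c : E × (E →L[ℝ] ℝ), fderiv ℝ (fun y =>
      formInChart (cotangentModel I) (canonicalAlternatingForm I M) z y ![v]) x₀ c = c.2 v.1 := by
    intro v c
    have h : (fun y => formInChart (cotangentModel I) (canonicalAlternatingForm I M) z y ![v])
        =ᶠ[𝓝 x₀] fun y => y.2 v.1 := by
      filter_upwards [extChartAt_target_mem_nhds (I := cotangentModel I) z] with y hy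
      exact formInChart_canonicalAlternatingForm z hy v
    rw [h.fderiv_eq]
    exact congrArg (fun T => T c)
      (((ContinuousLinearMap.apply ℝ ℝ v.1).comp (ContinuousLinearMap.snd ℝ E _)).fderiv
        (x := x₀))
  have h3 := extDeriv_apply_vectorField_of_pairwise_commute (V := fun i _ => V i)
    (differentiableAt_formInChart canonicalAlternatingForm_mem_smoothForms z)
    (fun i => differentiableAt_const _) (fun i j _ => by simp [lieBracket_eq])
  have e0 : Fin.removeNth 0 V = ![b] := by ext i <;> fin_cases i <;> rfl
  have e1 : Fin.removeNth 1 V = ![a] := by ext i <;> fin_cases i <;> rfl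
  rw [h1]
  refine h3.trans ?_
  rw [Fin.sum_univ_two]
  simp only [e0, e1]
  rw [h2, h2]
  simp [hV, sub_eq_add_neg]

theorem canonicalTwoForm_apply (z : CotangentBundle I M) (a b : E × (E →L[ℝ] ℝ)) :
    canonicalTwoForm I M z ![a, b] = b.2 a.1 - a.2 b.1 := by
  rw [canonicalTwoForm_eq, ContinuousAlternatingMap.neg_apply,
    mextDeriv_canonicalAlternatingForm_apply, neg_sub]

theorem isNondegenerate_canonicalTwoForm (z : CotangentBundle I M) :
    IsNondegenerate (canonicalTwoForm I M z) := by
  intro a ha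
  have h : ∀ b : E × (E →L[ℝ] ℝ), b.2 a.1 - a.2 b.1 = 0 := fun b =>
    (canonicalTwoForm_apply z a b).symm.trans (ha b)
  have h1 : a.1 = 0 := by
    by_contra h0
    obtain ⟨p, hp⟩ := SeparatingDual.exists_ne_zero (R := ℝ) h0
    exact hp (by simpa using h (0, p))
  have h2 : a.2 = 0 := by
    ext u
    simpa [h1] using h (u, 0)
  exact Prod.ext h1 h2

theorem canonicalTwoForm_mem_smoothForms :
    canonicalTwoForm I M ∈ smoothForms (cotangentModel I) (E × (E →L[ℝ] ℝ))
      (TCotangent I M) 2 :=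
  neg_mem (mextDeriv_mem_smoothForms (I := cotangentModel I) (N := CotangentBundle I M)
    canonicalAlternatingForm_mem_smoothForms)

theorem cyclicDer_canonicalTwoForm [Nontrivial E] (X Y Z : Cₛ^∞⟮cotangentModel I;
      E × (E →L[ℝ] ℝ), TCotangent I M⟯) (z : CotangentBundle I M) :
    cyclicDer (I := cotangentModel I) (canonicalTwoForm I M) X Y Z z = 0 := by
  have h := cyclicDer_mextDeriv (I := cotangentModel I) (N := CotangentBundle I M)
    canonicalAlternatingForm_mem_smoothForms X Y Z z
  rw [cyclicDer] at h ⊢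
  simp only [canonicalTwoForm_eq, ContinuousAlternatingMap.neg_apply, LieAlgebroid.der_neg]
  linarith

end Canonical

section TwoForms

variable {E : Type*} [NormedAddCommGroup E] [NormedSpace ℝ E] [FiniteDimensional ℝ E]
  {H : Type*} [TopologicalSpace H] {I : ModelWithCorners ℝ E H} [I.Boundaryless]
  {N : Type*} [TopologicalSpace N] [ChartedSpace H N] [IsManifold I ∞ N] [T2Space N]

local notation "𝔛" => Cₛ^∞⟮I; E, (fun x : N => TangentSpace I x)⟯

theorem wedgeForm_mem_smoothForms {α β : ∀ x : N, TangentSpace I x [⋀^Fin 2]→L[ℝ] ℝ}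
    (hα : α ∈ smoothForms I E (fun x : N => TangentSpace I x) 2)
    (hβ : β ∈ smoothForms I E (fun x : N => TangentSpace I x) 2) :
    (fun x => wedgeForm (α x) (β x)) ∈ smoothForms I E (fun x : N => TangentSpace I x) 4 := by
  intro X
  have ha := mem_smoothForms_two_iff.1 hα
  have hb := mem_smoothForms_two_iff.1 hβ
  exact ((((((ha _ _).mul (hb _ _)).sub ((ha _ _).mul (hb _ _))).add
    ((ha _ _).mul (hb _ _))).add ((ha _ _).mul (hb _ _))).sub ((ha _ _).mul (hb _ _))).add
    ((ha _ _).mul (hb _ _))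

theorem smul_mem_smoothForms {k : ℕ} {f : N → ℝ} (hf : ContMDiff I 𝓘(ℝ, ℝ) ∞ f)
    {α : ∀ x : N, TangentSpace I x [⋀^Fin k]→L[ℝ] ℝ}
    (hα : α ∈ smoothForms I E (fun x : N => TangentSpace I x) k) :
    (fun x => f x • α x) ∈ smoothForms I E (fun x : N => TangentSpace I x) k :=
  fun X => hf.mul (hα X)

variable {τ α : ∀ x : N, TangentSpace I x [⋀^Fin 2]→L[ℝ] ℝ}

theorem wedgeForm_self_ne_zero (hE : Module.finrank ℝ E = 4) {x : N}
    (hn : IsNondegenerate (τ x)) : wedgeForm (τ x) (τ x) ≠ 0 := fun h =>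
  haveI : FiniteDimensional ℝ (TangentSpace I x) := inferInstanceAs (FiniteDimensional ℝ E)
  hn.wedge_self_ne_zero hE (congrArg DFunLike.coe h)

theorem contMDiff_of_smul_wedge_eq (hE : Module.finrank ℝ E = 4)
    (hτ : τ ∈ smoothForms I E (fun x : N => TangentSpace I x) 2)
    (hα : α ∈ smoothForms I E (fun x : N => TangentSpace I x) 2)
    (hn : ∀ x, IsNondegenerate (τ x)) {c : N → ℝ}
    (hc : ∀ x, c x • wedge (τ x) (τ x) = wedge (α x) (α x)) : ContMDiff I 𝓘(ℝ, ℝ) ∞ c := by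
  intro x
  obtain ⟨e, he⟩ := exists_frame_of_ne_zero hE x (wedgeForm_self_ne_zero hE (hn x))
  have h1 := (wedgeForm_mem_smoothForms hα hα e) x
  have h2 := (wedgeForm_mem_smoothForms hτ hτ e) x
  refine (h1.div₀ h2 he).congr_of_eventuallyEq ?_
  filter_upwards [h2.continuousAt.eventually_ne he] with y hy
  refine (eq_div_iff hy).2 ?_
  exact congrFun (hc y) fun i => e i y

theorem contMDiff_endomorphism (hE : Module.finrank ℝ E = 4)
    (hτ : τ ∈ smoothForms I E (fun x : N => TangentSpace I x) 2)
    (hα : α ∈ smoothForms I E (fun x : N => TangentSpace I x) 2)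
    (hn : ∀ x, IsNondegenerate (τ x)) {A : ∀ x : N, TangentSpace I x →ₗ[ℝ] TangentSpace I x}
    (hA : ∀ x (u v : TangentSpace I x), τ x ![A x u, v] = α x ![u, v]) (X : 𝔛) :
    ContMDiff I (I.prod 𝓘(ℝ, E)) ∞ fun x => TotalSpace.mk' E x (A x (X x)) := by
  intro x
  obtain ⟨e, he⟩ := exists_frame_of_ne_zero hE x (wedgeForm_self_ne_zero hE (hn x))
  have hA' : ∀ x (u v : TangentSpace I x), τ x ![u, A x v] = α x ![u, v] := fun x u v => by
    rw [ContinuousAlternatingMap.two_swap, hA, ContinuousAlternatingMap.two_swap, neg_neg]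
  have h2 := (wedgeForm_mem_smoothForms hτ hτ e) x
  have ht := mem_smoothForms_two_iff.1 hτ
  have ha := mem_smoothForms_two_iff.1 hα
  have h3 : ∀ j, ContMDiff I 𝓘(ℝ, ℝ) ∞ fun y => wedgeForm (τ y) (τ y)
      (Function.update (fun i => e i y) j (A y (X y))) := by
    intro j
    simp only [wedgeForm_apply, wedge_self_apply]
    fin_cases j <;> simp [hA, hA'] <;>
    refine contMDiff_const.mul
      (((ContMDiff.mul ?_ ?_).sub (ContMDiff.mul ?_ ?_)).add (ContMDiff.mul ?_ ?_)) <;>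
    first | exact ht _ _ | exact ha _ _
  have h4 : ContMDiffAt I (I.prod 𝓘(ℝ, E)) ∞ (fun y => TotalSpace.mk' E y
      (∑ j, (wedgeForm (τ y) (τ y) (Function.update (fun i => e i y) j (A y (X y)))
        / wedgeForm (τ y) (τ y) (fun i => e i y)) • e j y)) x :=
    .sum_section fun j _ => ((h3 j x).div₀ h2 he).smul_section (e j).contMDiff.contMDiffAt
  refine h4.congr_of_eventuallyEq ?_
  filter_upwards [h2.continuousAt.eventually_ne he] with y hy
  have h5 := smoothForms_smul_eq_sum (α := fun x => wedgeForm (τ x) (τ x)) hE e y hy (A y (X y))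
  refine congrArg _ ?_
  simp only [div_eq_inv_mul, mul_smul]
  rw [← Finset.smul_sum, ← h5, inv_smul_smul₀ hy]

theorem cyclicDer_congr {x : N} (h : ∀ᶠ y in 𝓝 x, τ y = α y) (X Y Z : 𝔛) :
    cyclicDer τ X Y Z x = cyclicDer α X Y Z x := by
  have hd : ∀ X Y Z : 𝔛, (tangentLieAlgebroid I N).der X (fun y => τ y ![Y y, Z y]) x
      = (tangentLieAlgebroid I N).der X (fun y => α y ![Y y, Z y]) x := fun X Y Z =>
    LieAlgebroid.der_congr _ X (h.mono fun y hy => by simp only [hy])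
  rw [cyclicDer, cyclicDer, hd, hd, hd, h.self_of_nhds]

theorem cyclicDer_const_smul (hτ : τ ∈ smoothForms I E (fun x : N => TangentSpace I x) 2) (c : ℝ)
    (X Y Z : 𝔛) (x : N) : cyclicDer (c • τ) X Y Z x = c * cyclicDer τ X Y Z x := by
  have hd : ∀ X Y Z : 𝔛, (tangentLieAlgebroid I N).der X (fun y => (c • τ) y ![Y y, Z y]) x
      = c * (tangentLieAlgebroid I N).der X (fun y => τ y ![Y y, Z y]) x := fun X Y Z => by
    refine (LieAlgebroid.der_mul _ X (f := fun _ => c) contMDiff_const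
      (mem_smoothForms_two_iff.1 hτ Y Z) x).trans ?_
    rw [LieAlgebroid.der_const, zero_mul, add_zero]
  rw [cyclicDer, cyclicDer, hd, hd, hd]
  simp only [Pi.smul_apply, ContinuousAlternatingMap.smul_apply, smul_eq_mul]
  ring

theorem cyclicDer_eq_zero
    (hτ : τ ∈ smoothForms I E (fun x : N => TangentSpace I x) 2)
    {x : N} (hx : mextDeriv I τ x = 0) (X Y Z : 𝔛) : cyclicDer τ X Y Z x = 0 := by
  rw [cyclicDer, ← mextDeriv_two_apply hτ X Y Z x, hx]; rfl

theorem isNijenhuis_of_cyclicDer_eq_zero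
    (hτ : τ ∈ smoothForms I E (fun x : N => TangentSpace I x) 2)
    (hn : ∀ x, IsNondegenerate (τ x)) {J : EndField I E (fun x : N => TangentSpace I x)}
    (hJ : ∀ x (u v : TangentSpace I x), τ x ![J.toFun x u, v] = α x ![u, v])
    {c : N → ℝ} (hc : ∀ x, ∀ᶠ y in 𝓝 x, c y = c x)
    (hJJ : ∀ x (u : TangentSpace I x), J.toFun x (J.toFun x u) = -c x • u)
    (hdτ : ∀ X Y Z x, cyclicDer τ X Y Z x = 0) (hdα : ∀ X Y Z x, cyclicDer α X Y Z x = 0) :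
    (tangentLieAlgebroid I N).IsNijenhuis J := by
  intro X Y
  ext x
  refine hn x _ fun v => ?_
  obtain ⟨Z, rfl⟩ := exists_section_apply_eq (I := I) (F := E)
    (A := fun x : N => TangentSpace I x) x v
  have hJ' : ∀ x (u v : TangentSpace I x), τ x ![u, J.toFun x v] = α x ![u, v] := fun x u v => by
    rw [ContinuousAlternatingMap.two_swap, hJ, ContinuousAlternatingMap.two_swap, neg_neg]
  have hl : ∀ x (u v : TangentSpace I x), α x ![J.toFun x u, v] = (-c x • τ x) ![u, v] := by
    intro x u v
    rw [← hJ, hJJ, ContinuousAlternatingMap.two_smul_left, ContinuousAlternatingMap.smul_apply,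
      smul_eq_mul]
  have hr : ∀ x (u v : TangentSpace I x), α x ![u, J.toFun x v] = (-c x • τ x) ![u, v] := by
    intro x u v
    rw [← hJ', hJJ, ContinuousAlternatingMap.two_smul_right, ContinuousAlternatingMap.smul_apply,
      smul_eq_mul]
  have h4 : cyclicDer (fun y => -c y • τ y) X Y Z x = 0 := by
    rw [cyclicDer_congr (α := -c x • τ) ((hc x).mono fun y hy => by rw [hy]; rfl),
      cyclicDer_const_smul hτ, hdτ, mul_zero]
  have h1 := hdα (J.app X) Y Z x
  have h2 := hdα X (J.app Y) Z x
  have h3 := hdτ (J.app X) (J.app Y) Z x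
  simp only [cyclicDer, EndField.app_apply, hJ, hJ', hl, hr] at h1 h2 h3 h4
  have hneg : ∀ u v : TangentSpace I x, τ x ![-u, v] = -τ x ![u, v] := fun u v => by
    simpa using (τ x).two_smul_left (-1) u v
  simp only [sub_eq_add_neg, ContMDiffSection.coe_add, ContMDiffSection.coe_neg, Pi.add_apply,
    Pi.neg_apply, EndField.app_apply, map_add, ContinuousAlternatingMap.two_add_left, hneg, hJ, hl]
  linarith

theorem trace_eq_zero_of_wedge_eq_zero (hE : Module.finrank ℝ E = 4) {x : N}
    (hn : IsNondegenerate (τ x)) {A : TangentSpace I x →ₗ[ℝ] TangentSpace I x}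
    (hA : ∀ u v, τ x ![A u, v] = α x ![u, v]) (hατ : wedge (α x) (τ x) = 0) :
    LinearMap.trace ℝ (TangentSpace I x) A = 0 := by
  let b : Module.Basis (Fin 4) ℝ (TangentSpace I x) :=
    (Module.finBasisOfFinrankEq ℝ E hE : Module.Basis (Fin 4) ℝ E)
  have hb : (wedgeForm (τ x) (τ x)).toAlternatingMap b ≠ 0 := by
    rw [AlternatingMap.map_basis_ne_zero_iff]
    intro h
    exact wedgeForm_self_ne_zero hE hn
      (ContinuousAlternatingMap.toAlternatingMap_injective h)
  have h := AlternatingMap.sum_update_basis_eq_trace b (wedgeForm (τ x) (τ x)).toAlternatingMap A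
  exact (mul_eq_zero.1 (h.symm.trans (sum_wedge_self_update_eq_zero hA hατ b))).resolve_right hb

theorem LieAlgebroid.classOf_eq_zero {F : Type*} [NormedAddCommGroup F] [NormedSpace ℝ F]
    {A : N → Type*} [TopologicalSpace (TotalSpace F A)]
    [∀ x, AddCommGroup (A x)] [∀ x, Module ℝ (A x)] [∀ x, TopologicalSpace (A x)]
    [FiberBundle F A] [VectorBundle ℝ F A] {L : LieAlgebroid I F A}
    {ξ : ∀ x : N, A x →ₗ[ℝ] ℝ} (h : ξ ∈ L.cocycles) (h0 : ξ = 0) : L.classOf ξ h = 0 := by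
  subst h0
  exact Subtype.ext (map_zero _)

theorem LieAlgebroid.IsDeformation.isModularClass_iff_eq_zero {k : ℕ}
    (hk : Module.finrank ℝ E = k) {L : LieAlgebroid I E (fun x : N => TangentSpace I x)}
    {J : EndField I E (fun x : N => TangentSpace I x)}
    (hL : (tangentLieAlgebroid I N).IsDeformation L J)
    {μ : ∀ x : N, TangentSpace I x [⋀^Fin k]→L[ℝ] ℝ}
    (hμ : μ ∈ smoothForms I E (fun x : N => TangentSpace I x) k) (hμ0 : ∀ x, μ x ≠ 0)
    (hJ : ∀ x (v : Fin k → TangentSpace I x),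
      ∑ i, μ x (Function.update v i (J.toFun x (v i))) = 0) (c : L.H1) :
    L.IsModularClass c ↔ c = 0 := by
  subst hk
  constructor
  · rintro ⟨l, v, ξ, hξ, hl, hv, hm, rfl⟩
    exact Subtype.ext ((Submodule.Quotient.mk_eq_zero _).2
      (hL.mem_coboundaries_of_isModularForm ⟨hμ, hμ0⟩ hJ hl hv hm))
  · rintro rfl
    refine ⟨μ, μ, 0, zero_mem _, ⟨hμ, hμ0⟩, ⟨hμ, hμ0⟩, hL.isModularForm_zero ⟨hμ, hμ0⟩ hJ, ?_⟩
    exact Subtype.ext (map_zero _).symm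

end TwoForms

section Pfaffian

variable {N : Type*} [TopologicalSpace N]

theorem contDiffAt_inv_sqrt_abs {t : ℝ} (ht : t ≠ 0) :
    ContDiffAt ℝ ∞ (fun t : ℝ => (Real.sqrt |t|)⁻¹) t := by
  have h1 : ContDiffAt ℝ ∞ (fun t : ℝ => Real.sqrt |t|) t :=
    (contDiffAt_abs ht).sqrt (abs_ne_zero.2 ht)
  exact h1.inv (Real.sqrt_ne_zero'.2 (abs_pos.2 ht))

theorem eventually_inv_abs_mul_self_eq {f : N → ℝ} (hf : Continuous f) {x : N} (hx : f x ≠ 0) :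
    ∀ᶠ y in 𝓝 x, |f y|⁻¹ * f y = |f x|⁻¹ * f x := by
  rcases lt_or_gt_of_ne hx with h | h
  · filter_upwards [hf.continuousAt.eventually_lt_const h] with y hy
    rw [abs_of_neg h, abs_of_neg hy, inv_neg, inv_neg, neg_mul, neg_mul,
      inv_mul_cancel₀ hy.ne, inv_mul_cancel₀ hx]
  · filter_upwards [hf.continuousAt.eventually_const_lt h] with y hy
    rw [abs_of_pos h, abs_of_pos hy, inv_mul_cancel₀ hy.ne', inv_mul_cancel₀ hx]

end Pfaffian

section MongeAmpere

variable {E : Type*} [NormedAddCommGroup E] [NormedSpace ℝ E] [FiniteDimensional ℝ E]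
  {H : Type*} [TopologicalSpace H] {I : ModelWithCorners ℝ E H} [I.Boundaryless]
  {M : Type*} [TopologicalSpace M] [ChartedSpace H M] [IsManifold I ∞ M] [T2Space M]

theorem finrank_prod_dual {n : ℕ} (hE : Module.finrank ℝ E = n) :
    Module.finrank ℝ (E × (E →L[ℝ] ℝ)) = n + n := by
  rw [Module.finrank_prod, ← (LinearMap.toContinuousLinearMap (𝕜 := ℝ) (E := E)
    (F' := ℝ)).finrank_eq, Module.finrank_linearMap, Module.finrank_self, mul_one, hE]

theorem canonicalTwoForm_normalizedTensor
    (w : ∀ z : CotangentBundle I M, TCotangent I M z [⋀^Fin 2]→L[ℝ] ℝ) (z : CotangentBundle I M)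
    (u v : TCotangent I M z) :
    canonicalTwoForm I M z ![normalizedTensor I w z u, v] = normalizedForm I w z ![u, v] :=
  haveI : FiniteDimensional ℝ (TCotangent I M z) :=
    inferInstanceAs (FiniteDimensional ℝ (E × (E →L[ℝ] ℝ)))
  (isNondegenerate_canonicalTwoForm z).apply_inverseSharp_flat _ u v

namespace IsMongeAmpere

variable {w : ∀ z : CotangentBundle I M, TCotangent I M z [⋀^Fin 2]→L[ℝ] ℝ}

theorem contMDiff_pf (hw : IsMongeAmpere I w) (hE : Module.finrank ℝ E = 2)
    (hnd : ∀ z, Pf I w z ≠ 0) : ContMDiff (cotangentModel I) 𝓘(ℝ, ℝ) ∞ (Pf I w) :=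
  contMDiff_of_smul_wedge_eq (finrank_prod_dual hE) canonicalTwoForm_mem_smoothForms hw.1
    isNondegenerate_canonicalTwoForm fun z => pfaffian_smul_wedge (hnd z)

theorem normalizedForm_mem_smoothForms (hw : IsMongeAmpere I w) (hE : Module.finrank ℝ E = 2)
    (hnd : ∀ z, Pf I w z ≠ 0) : normalizedForm I w ∈ smoothForms (cotangentModel I)
      (E × (E →L[ℝ] ℝ)) (TCotangent I M) 2 :=
  smul_mem_smoothForms (fun z =>
    (contDiffAt_inv_sqrt_abs (hnd z)).comp_contMDiffAt (hw.contMDiff_pf hE hnd z)) hw.1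

theorem wedge_normalizedForm (hw : IsMongeAmpere I w) (z : CotangentBundle I M) :
    wedge (normalizedForm I w z) (canonicalTwoForm I M z) = 0 := by
  rw [normalizedForm, wedge_smul_left, hw.2, smul_zero]

theorem smul_wedge_eq_wedge_normalizedForm {z : CotangentBundle I M} (hnd : Pf I w z ≠ 0) :
    (|Pf I w z|⁻¹ * Pf I w z) • wedge (canonicalTwoForm I M z) (canonicalTwoForm I M z)
      = wedge (normalizedForm I w z) (normalizedForm I w z) := by
  rw [normalizedForm, wedge_smul_smul, ← pfaffian_smul_wedge hnd, smul_smul, inv_pow,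
    Real.sq_sqrt (abs_nonneg _)]
  rfl

/-- The field of endomorphisms `J_w` of a Monge-Ampère structure with non-vanishing Pfaffian. -/
def endField (hw : IsMongeAmpere I w) (hE : Module.finrank ℝ E = 2) (hnd : ∀ z, Pf I w z ≠ 0) :
    EndField (cotangentModel I) (E × (E →L[ℝ] ℝ)) (TCotangent I M) where
  toFun := normalizedTensor I w
  smooth := contMDiff_endomorphism (finrank_prod_dual hE) canonicalTwoForm_mem_smoothForms
    (hw.normalizedForm_mem_smoothForms hE hnd) isNondegenerate_canonicalTwoForm
    (canonicalTwoForm_normalizedTensor w)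

theorem normalizedTensor_normalizedTensor (hw : IsMongeAmpere I w) (hE : Module.finrank ℝ E = 2)
    {z : CotangentBundle I M} (hnd : Pf I w z ≠ 0) (u : TCotangent I M z) :
    normalizedTensor I w z (normalizedTensor I w z u) = -(|Pf I w z|⁻¹ * Pf I w z) • u :=
  haveI : FiniteDimensional ℝ (TCotangent I M z) :=
    inferInstanceAs (FiniteDimensional ℝ (E × (E →L[ℝ] ℝ)))
  (isNondegenerate_canonicalTwoForm z).apply_apply_eq (finrank_prod_dual hE)
    (canonicalTwoForm_normalizedTensor w z) (hw.wedge_normalizedForm z)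
    (smul_wedge_eq_wedge_normalizedForm hnd) u

theorem isNijenhuis_endField (hw : IsMongeAmpere I w) (hE : Module.finrank ℝ E = 2)
    (hnd : ∀ z, Pf I w z ≠ 0)
    (hclosed : ∀ z, mextDeriv (cotangentModel I) (normalizedForm I w) z = 0) :
    (tangentLieAlgebroid (cotangentModel I) (CotangentBundle I M)).IsNijenhuis
      (hw.endField hE hnd) := by
  have : Nontrivial E := Module.nontrivial_of_finrank_pos (R := ℝ) (by omega)
  exact isNijenhuis_of_cyclicDer_eq_zero (τ := canonicalTwoForm I M) (α := normalizedForm I w)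
    (c := fun z => |Pf I w z|⁻¹ * Pf I w z)
    canonicalTwoForm_mem_smoothForms isNondegenerate_canonicalTwoForm
    (canonicalTwoForm_normalizedTensor w)
    (fun z => eventually_inv_abs_mul_self_eq (hw.contMDiff_pf hE hnd).continuous (hnd z))
    (fun z u => hw.normalizedTensor_normalizedTensor hE (hnd z) u)
    cyclicDer_canonicalTwoForm
    (fun X Y Z z => cyclicDer_eq_zero (hw.normalizedForm_mem_smoothForms hE hnd) (hclosed z) X Y Z)

theorem trace_normalizedTensor (hw : IsMongeAmpere I w) (hE : Module.finrank ℝ E = 2)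
    (z : CotangentBundle I M) :
    LinearMap.trace ℝ (TCotangent I M z) (normalizedTensor I w z) = 0 :=
  trace_eq_zero_of_wedge_eq_zero (finrank_prod_dual hE) (isNondegenerate_canonicalTwoForm z)
    (canonicalTwoForm_normalizedTensor w z) (hw.wedge_normalizedForm z)

theorem dTrace_normalizedTensor (hw : IsMongeAmpere I w) (hE : Module.finrank ℝ E = 2) :
    dTrace I (normalizedTensor I w) = 0 := by
  funext z
  simp only [dTrace, hw.trace_normalizedTensor hE]
  rw [mvfderiv_const]
  rfl

theorem isModularClass_iff_eq_zero (hw : IsMongeAmpere I w) (hE : Module.finrank ℝ E = 2)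
    (hnd : ∀ z, Pf I w z ≠ 0)
    {L : LieAlgebroid (cotangentModel I) (E × (E →L[ℝ] ℝ)) (TCotangent I M)}
    (hL : (tangentLieAlgebroid (cotangentModel I) (CotangentBundle I M)).IsDeformation L
      (hw.endField hE hnd)) (c : L.H1) : L.IsModularClass c ↔ c = 0 :=
  hL.isModularClass_iff_eq_zero (finrank_prod_dual hE)
    (wedgeForm_mem_smoothForms canonicalTwoForm_mem_smoothForms canonicalTwoForm_mem_smoothForms)
    (fun z => wedgeForm_self_ne_zero (finrank_prod_dual hE) (isNondegenerate_canonicalTwoForm z))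
    (fun z v => sum_wedge_self_update_eq_zero (canonicalTwoForm_normalizedTensor w z)
      (hw.wedge_normalizedForm z) v) c

end IsMongeAmpere

end MongeAmpere

end

theorem mainTheorem9 {M : Type*} [TopologicalSpace M] [T2Space M]
    [ChartedSpace (EuclideanSpace ℝ (Fin 2)) M] [IsManifold (𝓡 2) ∞ M]
    (w : ∀ z : CotangentBundle (𝓡 2) M, TCotangent (𝓡 2) M z [⋀^Fin 2]→L[ℝ] ℝ)
    (hw : IsMongeAmpere (𝓡 2) w)
    (hnd : ∀ z, Pf (𝓡 2) w z ≠ 0)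
    (hclosed : ∀ z, mextDeriv (cotangentModel (𝓡 2)) (normalizedForm (𝓡 2) w) z = 0) :
    ∃ J : EndField (cotangentModel (𝓡 2))
        (EuclideanSpace ℝ (Fin 2) × (EuclideanSpace ℝ (Fin 2) →L[ℝ] ℝ)) (TCotangent (𝓡 2) M),
      (∀ z, J.toFun z = normalizedTensor (𝓡 2) w z) ∧
      (tangentLieAlgebroid (cotangentModel (𝓡 2)) (CotangentBundle (𝓡 2) M)).IsNijenhuis J ∧
      (∀ z, LinearMap.trace ℝ (TCotangent (𝓡 2) M z) (J.toFun z) = 0) ∧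
      ∃ L : LieAlgebroid (cotangentModel (𝓡 2))
          (EuclideanSpace ℝ (Fin 2) × (EuclideanSpace ℝ (Fin 2) →L[ℝ] ℝ)) (TCotangent (𝓡 2) M),
        (tangentLieAlgebroid (cotangentModel (𝓡 2))
          (CotangentBundle (𝓡 2) M)).IsDeformation L J ∧
        (∃ h : dTrace (𝓡 2) J.toFun ∈ L.cocycles,
          ∀ c : L.H1, L.IsModularClass c ↔ c = L.classOf (dTrace (𝓡 2) J.toFun) h) ∧
        L.IsUnimodular := by
  have hE : Module.finrank ℝ (EuclideanSpace ℝ (Fin 2)) = 2 := finrank_euclideanSpace_fin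
  have hN := hw.isNijenhuis_endField hE hnd hclosed
  have hL := LieAlgebroid.isDeformation_deform _ _ hN
  have hd := hw.dTrace_normalizedTensor hE
  have hm := hw.isModularClass_iff_eq_zero hE hnd hL
  refine ⟨hw.endField hE hnd, fun _ => rfl, hN, hw.trace_normalizedTensor hE, _, hL,
    ⟨?_, fun c => ?_⟩, (hm 0).2 rfl⟩
  · rw [show (hw.endField hE hnd).toFun = normalizedTensor (𝓡 2) w from rfl, hd]
    exact zero_mem _
  · exact (hm c).trans (Eq.congr_right (LieAlgebroid.classOf_eq_zero _ hd).symm)
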